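/- **Setting (binary Hamming case).** Let $X^n$ be i.i.d. $\mathrm{Ber}(\frac12)$, let receiver $k\in\{b,g\}$ observe the side information $Y_k^n=X^n\oplus N_k^n$ with $N_k^n$ i.i.d. $\mathrm{Ber}(\beta_k)$ independent of $X^n$, and, when the channel input is $U^m$, the channel output $V_k^m=U^m\oplus W_k^m$ with $W_k^m$ i.i.d. $\mathrm{Ber}(p_k)$ independent of $(X^n,N_k^n)$; here $p_k,\beta_k\in[0,1]$. Receiver $g$ has the better channel: $U-V_g-V_b$, i.e. the channel to $b$ is a degraded version of the channel to $g$. Likewise $X-Y_g-Y_b$ (resp. $X-Y_b-Y_g$) means that $Y_b$ is a degraded version of $Y_g$ (resp. $Y_g$ of $Y_b$); Markov chains are understood up to the choice of the joint law of the two receivers' noises, which plays no role. Distortion is the normalized Hamming distance $d(x^n,\hat x^n)=\frac1n|\{j:x_j\neq\hat x_j\}|$. Write $a\star b=(1-a)b+a(1-b)$, $H_2(p)=-p\log_2p-(1-p)\log_2(1-p)$, $r(\alpha,\beta)=H_2(\alpha\star\beta)-H_2(\alpha)$ and $[t]^+=\max(t,0)$. **Achievability.** Let $\kappa>0$ be rational.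 The pair $(D_b,D_g)$ is *achievable at rate $\kappa$* if for every $\epsilon>0$ there is $n_0$ such that for all integers $m>0$, $n>n_0$ with $m/n=\kappa$ there are an encoder $\phi:\{0,1\}^n\to\{0,1\}^m$ and decoders $\psi_b,\psi_g:\{0,1\}^m\times\{0,1\}^n\to\{0,1\}^n$ such that, with $U^m=\phi(X^n)$, $\mathrm E[d(X^n,\psi_k(V_k^m,Y_k^n))]\le D_k+\epsilon$ for $k\in\{b,g\}$. It is *achievable by separate source and channel coding* if $\mathcal R(D_b,D_g)\cap\mathcal C(\kappa)\ne\emptyset$. Here $\mathcal R(D_b,D_g)$ is the set of $(R_b,R_g)$ such that for every $\epsilon>0$ and all large $n$ the word $X^n$ can be encoded into a pair of indices $(i,j)$, with at most $2^{n(R_b+\epsilon)}$ values of $i$ and at most $2^{n(R_g+\epsilon)}$ values of $(i,j)$, so that $b$ from $(i,Y_b^n)$ and $g$ from $(i,j,Y_g^n)$ reconstruct $X^n$ with expected distortions at most $D_b+\epsilon$ and $D_g+\epsilon$. The set $\mathcal C(\kappa)$ consists of the $(R_b,R_g)$ such that for every $\epsilon>0$ and all large $n$ with $m=\kappa n$ an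 integer, there is a code of block length $m$ for the broadcast channel with uniform messages $(i,j)$, with at least $2^{n(R_b-\epsilon)}$ values of $i$ and at least $2^{n(R_g-\epsilon)}$ values of $(i,j)$, for which $b$ decodes $i$ and $g$ decodes $(i,j)$, each with average error probability at most $\epsilon$. **Lemma.** The pair $(D_b,D_g)$ is achievable at rate $\kappa$, and is in fact achievable by separate source and channel coding, whenever there exist $\theta\in[0,1]$, $q_b,q_g\in[0,1]$ and $\alpha_b,\alpha_g\in[0,\frac12]$ such that $$q_b\,r(\alpha_b,\beta_b)\le\kappa\,[1-H_2(\theta\star p_b)],$$ $$q_b\,r(\alpha_b,\beta_b)+[q_g\,r(\alpha_g,\beta_g)-q_b\,r(\alpha_b,\beta_g)]^+\le\kappa\,[H_2(\theta\star p_g)-H_2(p_g)]\quad\text{if }X-Y_g-Y_b,$$ $$q_g\,r(\alpha_g,\beta_g)+[q_b\,r(\alpha_b,\beta_b)-q_g\,r(\alpha_g,\beta_b)]^+\le\kappa\,[H_2(\theta\star p_g)-H_2(p_g)]\quad\text{if }X-Y_b-Y_g,$$ $$D_i\ge q_i\min\{\alpha_i,\beta_i\}+(1-q_i)\beta_i,\qquad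 i\in\{b,g\}.$$ -/

import Mathlib

namespace WZBC

/-- Binary convolution `a ⋆ b`. -/
def binConv (a b : ℝ) : ℝ := (1 - a) * b + a * (1 - b)

/-- The binary entropy function in bits (`Real.binEntropy` is in nats). -/
noncomputable def H2 (p : ℝ) : ℝ := Real.binEntropy p / Real.log 2

/-- `r(α, β) = H₂(α ⋆ β) - H₂(α)`. -/
noncomputable def r (α β : ℝ) : ℝ := H2 (binConv α β) - H2 α

/-- Transition probability from `a` to `b` of the binary symmetric channel with
crossover probability `p`, i.e. of `b = a ⊕ N` with `N ∼ Ber(p)` independent of `a`. -/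
def bsc (p : ℝ) (a b : Bool) : ℝ := if a = b then 1 - p else p

/-- Transition probability of the memoryless binary symmetric channel on words of length `k`. -/
def bscWord (p : ℝ) {k : ℕ} (a b : Fin k → Bool) : ℝ := ∏ i, bsc p (a i) (b i)

/-- Degradedness: the output `T` of the binary symmetric channel with parameter `b` can be obtained
from the output `S` of the one with parameter `a` by further processing that does not see the
input `X`. Equivalently, `(X, S, T)` has a joint law with the given marginals `(X, S)` and `(X, T)`
for which `X - S - T` is a Markov chain, whatever the law of `X`. -/
def IsDegraded (a b : ℝ) : Prop :=
  ∃ K : Bool → Bool → ℝ, (∀ s t, 0 ≤ K s t) ∧ (∀ s, ∑ t, K s t = 1) ∧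
    ∀ x t, bsc b x t = ∑ s, bsc a x s * K s t

/-- The expectation of `f (X^n, Y^n)`, where `X^n` is i.i.d. `Ber(1/2)` and `Y^n = X^n ⊕ N^n` with
`N^n` i.i.d. `Ber(β)` and independent of `X^n`. -/
noncomputable def sourceMean (β : ℝ) {n : ℕ} (f : (Fin n → Bool) → (Fin n → Bool) → ℝ) : ℝ :=
  ∑ x : Fin n → Bool, (1 / 2 : ℝ) ^ n * ∑ y : Fin n → Bool, bscWord β x y * f x y

/-- Normalized Hamming distortion of two words. -/
noncomputable def distortion {n : ℕ} (x z : Fin n → Bool) : ℝ := (hammingDist x z : ℝ) / n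

/-! ### Joint source-channel codes -/

/-- A code: `n` source symbols, `m` channel uses, and one decoder for each of the two receivers
`b` and `g`, acting on the channel output and the side information. -/
structure Code (m n : ℕ) where
  enc : (Fin n → Bool) → (Fin m → Bool)
  decB : (Fin m → Bool) → (Fin n → Bool) → (Fin n → Bool)
  decG : (Fin m → Bool) → (Fin n → Bool) → (Fin n → Bool)

/-- Expected distortion at a receiver with channel parameter `p`, side information parameter `β`,
and decoder `dec`, when the encoder is `enc`. -/
noncomputable def expDistortion (p β : ℝ) {m n : ℕ} (enc : (Fin n → Bool) → (Fin m → Bool))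
    (dec : (Fin m → Bool) → (Fin n → Bool) → (Fin n → Bool)) : ℝ :=
  sourceMean β fun x y => ∑ v : Fin m → Bool, bscWord p (enc x) v * distortion x (dec v y)

/-- Achievability of the distortion pair `(Db, Dg)` at rate `κ` channel uses per source symbol. -/
def Achievable (κ : ℚ) (pb pg βb βg Db Dg : ℝ) : Prop :=
  ∀ ε : ℝ, 0 < ε → ∃ n₀ : ℕ, ∀ m n : ℕ, 0 < m → n₀ < n → (m : ℚ) / n = κ →
    ∃ c : Code m n,
      expDistortion pb βb c.enc c.decB ≤ Db + ε ∧ expDistortion pg βg c.enc c.decG ≤ Dg + ε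

/-! ### Separate source and channel codes -/

/-- A two-layer source code: receiver `b` gets the first index, receiver `g` gets both. -/
structure SourceCode (n Mb Mp : ℕ) where
  enc : (Fin n → Bool) → Fin Mb × Fin Mp
  decB : Fin Mb → (Fin n → Bool) → (Fin n → Bool)
  decG : Fin Mb × Fin Mp → (Fin n → Bool) → (Fin n → Bool)

/-- The pairs `(Rb, Rg)` of total rates (in bits per source symbol) that, when delivered to the two
receivers, allow reconstruction within `Db` and `Dg`; the rate at `g` is cumulative. -/
def sourceRegion (βb βg Db Dg : ℝ) : Set (ℝ × ℝ) :=
  {R | ∀ ε : ℝ, 0 < ε → ∃ n₀ : ℕ, ∀ n : ℕ, n₀ < n →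
    ∃ (Mb Mp : ℕ) (c : SourceCode n Mb Mp),
      Real.logb 2 Mb ≤ n * (R.1 + ε) ∧ Real.logb 2 (Mb * Mp) ≤ n * (R.2 + ε) ∧
      sourceMean βb (fun x y => distortion x (c.decB (c.enc x).1 y)) ≤ Db + ε ∧
      sourceMean βg (fun x y => distortion x (c.decG (c.enc x) y)) ≤ Dg + ε}

/-- A broadcast channel code: receiver `b` decodes the first message, receiver `g` both. -/
structure ChannelCode (m Mb Mp : ℕ) where
  enc : Fin Mb × Fin Mp → (Fin m → Bool)
  decB : (Fin m → Bool) → Fin Mb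
  decG : (Fin m → Bool) → Fin Mb × Fin Mp

/-- Error probability at `b`, averaged over uniform messages. -/
noncomputable def ChannelCode.errB {m Mb Mp : ℕ} (c : ChannelCode m Mb Mp) (p : ℝ) : ℝ :=
  (∑ w : Fin Mb × Fin Mp, ∑ v : Fin m → Bool,
    bscWord p (c.enc w) v * (if c.decB v = w.1 then 0 else 1)) / (Mb * Mp)

/-- Error probability at `g`, averaged over uniform messages. -/
noncomputable def ChannelCode.errG {m Mb Mp : ℕ} (c : ChannelCode m Mb Mp) (p : ℝ) : ℝ :=
  (∑ w : Fin Mb × Fin Mp, ∑ v : Fin m → Bool,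
    bscWord p (c.enc w) v * (if c.decG v = w then 0 else 1)) / (Mb * Mp)

/-- The capacity region for `κ` channel uses per source symbol: the pairs `(Rb, Rg)` of total rates
(in bits per source symbol) that can be decoded at the two receivers simultaneously with vanishing
error probability; the rate at `g` is cumulative. -/
def capacityRegion (κ : ℚ) (pb pg : ℝ) : Set (ℝ × ℝ) :=
  {R | ∀ ε : ℝ, 0 < ε → ∃ n₀ : ℕ, ∀ m n : ℕ, 0 < m → n₀ < n → (m : ℚ) / n = κ →
    ∃ (Mb Mp : ℕ) (c : ChannelCode m Mb Mp), 0 < Mb ∧ 0 < Mp ∧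
      n * (R.1 - ε) ≤ Real.logb 2 Mb ∧ n * (R.2 - ε) ≤ Real.logb 2 (Mb * Mp) ∧
      c.errB pb ≤ ε ∧ c.errG pg ≤ ε}

/-- Achievability by separate source and channel coding: some rate pair is sufficient for the source
and supported by the broadcast channel. -/
def SeparatelyAchievable (κ : ℚ) (pb pg βb βg Db Dg : ℝ) : Prop :=
  (sourceRegion βb βg Db Dg ∩ capacityRegion κ pb pg).Nonempty

end WZBC

/-! Both versions of the rate condition at `g` imply that `qg * r αg βg` alone is at most the
satellite rate κ[H₂(θ⋆p_g) − H₂(p_g)]. If Y_b is degraded from Y_g, then r(α_b,β_g) ≤ r(α_b,β_b), so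
dropping the truncation leaves at least q_g r(α_g,β_g); if Y_g is degraded from Y_b, that term
appears outright, plus something nonnegative. So no successive refinement is needed. Two unrelated
Wyner-Ziv codes serve the two receivers: the index for `b` is the cloud message of a superposition
code and the index for `g` is the satellite message. Receiver `g` decodes both and discards the
first.

The source code (`exists_binning_code`, `exists_block_code`) is random binning on the group of
binary words. A uniform codebook is split into bins; the encoder sends a bin containing a word at
typical Ber(α) difference from x, and the decoder looks in the bin for the word whose difference
from y is typical for Ber(α⋆β). Coding only a fraction q of the symbols and copying y elsewhere
gives the distortion q·min(α,β) + (1−q)β (`exists_wynerZiv_code`).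

The channel code (`exists_superposition_code`, `exists_channel_code`) has uniform cloud centres and
Ber(θ) satellites. Degradedness makes the cloud rate allowed by `b` decodable at `g` too.

For an actual joint code two gaps remain. The source indices are not uniform, whereas channel errors
are averaged over uniform messages; a deterministic shift of the message pair repairs this
(`exists_code_of_separate`). And the channel code falls slightly short of its nominal rates; the
source code absorbs this, since a positive Wyner-Ziv rate can be lowered a little at a small cost in
distortion. -/

namespace WZBC

/-! ### Expectations over i.i.d. families on a finite alphabet -/

section IID

variable {ι G : Type*} [Fintype ι] [DecidableEq ι] [Fintype G]

/-- `P` is a probability mass function on a finite type. -/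
structure IsProb (P : G → ℝ) : Prop where
  nonneg : ∀ x, 0 ≤ P x
  sum_eq_one : ∑ x, P x = 1

/-- The expectation of `F c` for a family `c` of independent elements of `G` of law `P`. -/
noncomputable def iidMean (P : G → ℝ) (F : (ι → G) → ℝ) : ℝ :=
  ∑ c : ι → G, (∏ i, P (c i)) * F c

/-- This is the only form in which independence enters: setting all but one or two factors to 1
yields total mass, marginals and pair products. -/
theorem iidMean_prod (P : G → ℝ) (h : ι → G → ℝ) :
    iidMean P (fun c => ∏ i, h i (c i)) = ∏ i, ∑ x, P x * h i x := by
  classical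
  rw [Finset.prod_univ_sum, Fintype.piFinset_univ]
  simp only [iidMean, Finset.prod_mul_distrib]

theorem IsProb.iid {P : G → ℝ} (hP : IsProb P) : IsProb fun c : ι → G => ∏ i, P (c i) where
  nonneg c := Finset.prod_nonneg fun i _ => hP.nonneg _
  sum_eq_one := by
    have := iidMean_prod P (fun (_ : ι) _ => 1)
    simpa [iidMean, hP.sum_eq_one] using this

theorem iidMean_mono {P : G → ℝ} (hP : IsProb P) {F F' : (ι → G) → ℝ} (h : ∀ c, F c ≤ F' c) :
    iidMean P F ≤ iidMean P F' :=
  Finset.sum_le_sum fun c _ => mul_le_mul_of_nonneg_left (h c) (hP.iid.nonneg c)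

theorem iidMean_const {P : G → ℝ} (hP : IsProb P) (a : ℝ) :
    iidMean P (fun _ : ι → G => a) = a := by
  rw [iidMean, ← Finset.sum_mul, hP.iid.sum_eq_one, one_mul]

theorem iidMean_add (P : G → ℝ) (F F' : (ι → G) → ℝ) :
    iidMean P (fun c => F c + F' c) = iidMean P F + iidMean P F' := by
  simp only [iidMean, mul_add, Finset.sum_add_distrib]

theorem iidMean_mul_left (P : G → ℝ) (a : ℝ) (F : (ι → G) → ℝ) :
    iidMean P (fun c => a * F c) = a * iidMean P F := by
  simp only [iidMean, Finset.mul_sum]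
  exact Finset.sum_congr rfl fun c _ => by ring

theorem iidMean_sum {κ : Type*} (P : G → ℝ) (s : Finset κ) (F : κ → (ι → G) → ℝ) :
    iidMean P (fun c => ∑ k ∈ s, F k c) = ∑ k ∈ s, iidMean P (F k) := by
  simp only [iidMean, Finset.mul_sum]
  exact Finset.sum_comm

theorem iidMean_apply {P : G → ℝ} (hP : IsProb P) (a : ι) (f : G → ℝ) :
    iidMean P (fun c => f (c a)) = ∑ x, P x * f x := by
  have h := iidMean_prod P (fun i x => if i = a then f x else 1)
  have e1 : ∀ c : ι → G, (∏ i, if i = a then f (c i) else 1) = f (c a) := fun c => by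
    simp
  simp only [e1] at h
  rw [h, Finset.prod_eq_single a]
  · simp
  · intro b _ hb
    simp [hb, hP.sum_eq_one]
  · simp

theorem iidMean_apply_mul_apply {P : G → ℝ} (hP : IsProb P) {a b : ι} (hab : a ≠ b)
    (f g : G → ℝ) :
    iidMean P (fun c => f (c a) * g (c b)) = (∑ x, P x * f x) * ∑ x, P x * g x := by
  have h := iidMean_prod P (fun i x => (if i = a then f x else 1) * (if i = b then g x else 1))
  have e1 : ∀ c : ι → G, (∏ i, (if i = a then f (c i) else 1) * (if i = b then g (c i) else 1))
      = f (c a) * g (c b) := fun c => by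
    rw [Finset.prod_mul_distrib]; simp
  simp only [e1] at h
  rw [h, ← Finset.mul_prod_erase _ _ (Finset.mem_univ a),
    ← Finset.mul_prod_erase _ _ (Finset.mem_erase.2 ⟨hab.symm, Finset.mem_univ b⟩),
    Finset.prod_eq_one]
  · simp [hab, hab.symm]
  · intro i hi
    simp only [Finset.mem_erase] at hi
    simp [hi.1, hi.2.1, hP.sum_eq_one]

theorem iidMean_apply_two {P : G → ℝ} (hP : IsProb P) {a b : ι} (hab : a ≠ b)
    (F : G → G → ℝ) :
    iidMean P (fun c => F (c a) (c b)) = ∑ x, P x * ∑ y, P y * F x y := by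
  classical
  have e : ∀ c : ι → G, F (c a) (c b) = ∑ x, (if c a = x then 1 else 0) * F x (c b) := fun c => by
    simp
  simp only [e]
  rw [iidMean_sum]
  refine Finset.sum_congr rfl fun x _ => ?_
  rw [iidMean_apply_mul_apply hP hab (fun y => if y = x then 1 else 0) (F x)]
  simp

theorem IsProb.sum_mul_affine {P : G → ℝ} (hP : IsProb P) (a b : ℝ) (F : G → ℝ) :
    ∑ x, P x * (a + b * F x) = a + b * ∑ x, P x * F x := by
  simp only [mul_add, Finset.sum_add_distrib, ← Finset.sum_mul, hP.sum_eq_one, one_mul,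
    mul_left_comm (P _) b, ← Finset.mul_sum]

/-- The derandomisation step of random coding: an average bound is met by some outcome. -/
theorem exists_le_of_sum_mul_le {P : G → ℝ} (hP : IsProb P) {F : G → ℝ} {B : ℝ}
    (h : ∑ x, P x * F x ≤ B) : ∃ x, F x ≤ B := by
  by_contra! hc
  have h1 : ∑ x, P x * B < ∑ x, P x * F x := by
    obtain ⟨x, -, hx⟩ : ∃ x ∈ Finset.univ, 0 < P x := by
      apply Finset.exists_lt_of_sum_lt
      simp [hP.sum_eq_one]
    exact Finset.sum_lt_sum (fun x _ => mul_le_mul_of_nonneg_left (hc x).le (hP.nonneg x))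
      ⟨x, Finset.mem_univ x, mul_lt_mul_of_pos_left (hc x) hx⟩
  rw [← Finset.sum_mul, hP.sum_eq_one, one_mul] at h1
  linarith

theorem exists_le_of_iidMean_le {P : G → ℝ} (hP : IsProb P) {F : (ι → G) → ℝ} {B : ℝ}
    (h : iidMean P F ≤ B) : ∃ c, F c ≤ B :=
  exists_le_of_sum_mul_le hP.iid h

/-- The variance of a sum of independent centred variables. -/
theorem iidMean_sq_sum {P : G → ℝ} (hP : IsProb P) (f : G → ℝ) (hf : ∑ x, P x * f x = 0) :
    iidMean P (fun c : ι → G => (∑ i, f (c i)) ^ 2)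
      = Fintype.card ι * ∑ x, P x * f x ^ 2 := by
  have e : ∀ c : ι → G, (∑ i, f (c i)) ^ 2 = ∑ i, ∑ j, f (c i) * f (c j) := fun c => by
    rw [sq, Finset.sum_mul_sum]
  simp only [e, iidMean_sum]
  have h : ∀ i j : ι, iidMean P (fun c => f (c i) * f (c j))
      = if i = j then ∑ x, P x * f x ^ 2 else 0 := fun i j => by
    split_ifs with hij
    · subst hij
      simp only [← sq]
      exact iidMean_apply hP i fun x => f x ^ 2
    · rw [iidMean_apply_mul_apply hP hij, hf, zero_mul]
  simp [h]

/-- Chebyshev's inequality for sums of independent variables. -/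
theorem iidMean_deviation_le {P : G → ℝ} (hP : IsProb P) (f : G → ℝ) {t : ℝ} (ht : 0 < t) :
    iidMean P (fun c : ι → G =>
        if t ≤ |∑ i, f (c i) - Fintype.card ι * ∑ x, P x * f x| then 1 else 0)
      ≤ Fintype.card ι * (∑ x, P x * f x ^ 2) / t ^ 2 := by
  set μ := ∑ x, P x * f x with hμ
  have h0 : ∑ x, P x * (f x - μ) = 0 := by
    simp only [mul_sub, Finset.sum_sub_distrib, ← Finset.sum_mul, hP.sum_eq_one]
    rw [← hμ]; ring
  have h1 := iidMean_sq_sum (ι := ι) hP _ h0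
  have h2 : ∑ x, P x * (f x - μ) ^ 2 ≤ ∑ x, P x * f x ^ 2 := by
    have : ∑ x, P x * (f x - μ) ^ 2 = ∑ x, P x * f x ^ 2 - μ ^ 2 := by
      have e : ∀ x, P x * (f x - μ) ^ 2 = P x * f x ^ 2 - 2 * μ * (P x * f x) + P x * μ ^ 2 :=
        fun x => by ring
      simp only [e, Finset.sum_sub_distrib, Finset.sum_add_distrib, ← Finset.mul_sum,
        ← Finset.sum_mul, hP.sum_eq_one]
      rw [← hμ]; ring
    nlinarith [sq_nonneg μ]
  calc _ ≤ iidMean P (fun c : ι → G => (1 / t ^ 2) * (∑ i, (f (c i) - μ)) ^ 2) := by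
        refine iidMean_mono hP fun c => ?_
        have e : ∑ i, (f (c i) - μ) = ∑ i, f (c i) - Fintype.card ι * μ := by
          simp [Finset.sum_sub_distrib]
        rw [e]
        split_ifs with h
        · rw [one_div, ← div_eq_inv_mul, le_div_iff₀ (by positivity), one_mul, ← sq_abs (_ - _)]
          exact pow_le_pow_left₀ ht.le h 2
        · positivity
    _ = (1 / t ^ 2) * (Fintype.card ι * ∑ x, P x * (f x - μ) ^ 2) := by
        rw [iidMean_mul_left, h1]
    _ ≤ (1 / t ^ 2) * (Fintype.card ι * ∑ x, P x * f x ^ 2) := by gcongr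
    _ = _ := by ring

/-- The uniform law. -/
theorem isProb_uniform [Nonempty G] : IsProb fun _ : G => (1 / Fintype.card G : ℝ) where
  nonneg _ := by positivity
  sum_eq_one := by simp

end IID

/-- Decoding to an element that passes a test. -/
theorem exists_decoder {A B : Type*} [Nonempty B] (test : A → B → Prop) :
    ∃ dec : A → B, ∀ v b, test v b → (∀ b', b' ≠ b → ¬ test v b') → dec v = b := by
  classical
  refine ⟨fun v => if h : ∃ b, test v b then h.choose else Classical.arbitrary B, ?_⟩
  intro v b h1 h2
  have h : ∃ b, test v b := ⟨b, h1⟩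
  have hb : h.choose = b := by
    by_contra hne
    exact h2 _ hne h.choose_spec
  simp only [dif_pos h, hb]

theorem one_le_sum_indicator {K : Type*} (s : Finset K) (p : K → Prop) [DecidablePred p] {k : K}
    (hk : k ∈ s) (hp : p k) : (1 : ℝ) ≤ ∑ i ∈ s, if p i then 1 else 0 := by
  refine le_trans ?_ (Finset.single_le_sum (f := fun i => if p i then (1 : ℝ) else 0)
    (fun i _ => by split_ifs <;> norm_num) hk)
  simp [hp]

theorem sum_indicator_nonneg {K : Type*} (s : Finset K) (p : K → Prop) [DecidablePred p] :
    (0 : ℝ) ≤ ∑ i ∈ s, if p i then 1 else 0 :=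
  Finset.sum_nonneg fun i _ => by split_ifs <;> norm_num

theorem sum_mul_le_of_le {H : Type*} [Fintype H] {P : H → ℝ} (hP : IsProb P) {F : H → ℝ} {B : ℝ}
    (h : ∀ x, F x ≤ B) : ∑ x, P x * F x ≤ B := by
  refine (Finset.sum_le_sum fun x _ => mul_le_mul_of_nonneg_left (h x) (hP.nonneg x)).trans ?_
  rw [← Finset.sum_mul, hP.sum_eq_one, one_mul]

/-! ### One-shot binning on a finite group -/

section OneShot

variable {G I J : Type*} [AddCommGroup G] [Fintype G] [DecidableEq G]
  [Fintype I] [Fintype J] [DecidableEq I] [DecidableEq J]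

/-- A reflected translate of a uniform element is uniform, so every x is covered by a random
codeword with the same probability. -/
theorem sum_indicator_sub_mem (S : Finset G) (x : G) :
    ∑ g : G, (1 / Fintype.card G : ℝ) * (if x - g ∈ S then 1 else 0)
      = S.card / Fintype.card G := by
  have h := (Equiv.subLeft x).sum_comp (fun g => if g ∈ S then (1 : ℝ) else 0)
  simp only [Equiv.subLeft_apply] at h
  rw [← Finset.mul_sum, h]
  simp [div_eq_inv_mul]

/-- Random binning with a covering codebook on a finite group: if adding the noise takes the
covering set `S` to the decoding set `T` with high probability, then there are an encoder with `I`
messages and a decoder with side information `x + N` for which `x - dec` is in `S` with high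
probability. -/
theorem exists_binning_code [Nonempty I] [Nonempty J] {Q : G → ℝ} (hQ : IsProb Q)
    {S T : Finset G} {ε : ℝ} (hS : S.Nonempty)
    (hST : ∀ e ∈ S, ∑ N, Q N * (if e + N ∈ T then 0 else 1) ≤ ε) :
    ∃ (enc : G → I) (dec : I → G → G),
      ∑ x, (1 / Fintype.card G : ℝ) *
          ∑ N, Q N * (if x - dec (enc x) (x + N) ∈ S then 0 else 1)
        ≤ 4 * Fintype.card G / (Fintype.card I * Fintype.card J * S.card)
          + 2 * (ε + (Fintype.card J - 1) * T.card / Fintype.card G) := by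
  classical
  have hG0 : (0 : ℝ) < Fintype.card G := by exact_mod_cast Fintype.card_pos
  have hI0 : (0 : ℝ) < Fintype.card I := by exact_mod_cast Fintype.card_pos
  have hJ0 : (0 : ℝ) < Fintype.card J := by exact_mod_cast Fintype.card_pos
  have hS0 : (0 : ℝ) < S.card := by exact_mod_cast hS.card_pos
  set U : G → ℝ := fun _ => (1 / Fintype.card G : ℝ) with hU
  have hUp : IsProb U := isProb_uniform
  set p : ℝ := S.card / Fintype.card G with hp
  have hp0 : 0 < p := by positivity
  set L : ℝ := Fintype.card I * Fintype.card J with hL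
  have hL0 : 0 < L := by positivity
  set μ : ℝ := L * p with hμ
  have hμ0 : 0 < μ := by positivity
  set ind : G → (I × J → G) → I × J → ℝ := fun x c a => if x - c a ∈ S then 1 else 0 with hind
  set bad : G → (I × J → G) → I × J → ℝ := fun x c a =>
    ε + ∑ j ∈ Finset.univ.erase a.2, ∑ N, Q N * (if x + N - c (a.1, j) ∈ T then 1 else 0) with hbad
  -- A bound for the best bin at x that does not mention the decoder. Here μ is the expected number
  -- of codewords covering x. If fewer than μ/2 cover x, the first term is at least 1; otherwise the
  -- second dominates the mean of `bad` over the covering codewords. Only first and second moments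
  -- of the codebook are then needed.
  set A : G → (I × J → G) → ℝ := fun x c =>
    (4 / μ ^ 2) * (∑ a, (ind x c a - p)) ^ 2 + (2 / μ) * ∑ a, ind x c a * bad x c a with hA
  have hε : 0 ≤ ε := by
    obtain ⟨e, he⟩ := hS
    refine le_trans (Finset.sum_nonneg fun N _ => mul_nonneg (hQ.nonneg N) ?_) (hST e he)
    split_ifs <;> norm_num
  have hbad0 : ∀ x c a, 0 ≤ bad x c a := fun x c a => by
    refine add_nonneg hε (Finset.sum_nonneg fun j _ => Finset.sum_nonneg fun N _ =>
      mul_nonneg (hQ.nonneg N) ?_)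
    split_ifs <;> norm_num
  have hind0 : ∀ x c a, 0 ≤ ind x c a := fun x c a => by
    simp only [hind]; split_ifs <;> norm_num
  -- for every codebook
  have hcode : ∀ c : I × J → G, ∃ (enc : G → I) (dec : I → G → G), ∀ x,
      ∑ N, Q N * (if x - dec (enc x) (x + N) ∈ S then 0 else 1) ≤ A x c := by
    intro c
    have hdec : ∀ i : I, ∃ dec : G → J, ∀ y j, y - c (i, j) ∈ T →
        (∀ j', j' ≠ j → y - c (i, j') ∉ T) → dec y = j :=
      fun i => exists_decoder fun y j => y - c (i, j) ∈ T
    choose decJ hdecJ using hdec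
    set dec : I → G → G := fun i y => c (i, decJ i y) with hdec_def
    have hdec : ∀ i j y, y - c (i, j) ∈ T → (∀ j', j' ≠ j → y - c (i, j') ∉ T) →
        dec i y = c (i, j) := fun i j y h1 h2 => by
      simp only [hdec_def, hdecJ i y j h1 h2]
    have hle1 : ∀ x i, ∑ N, Q N * (if x - dec i (x + N) ∈ S then (0 : ℝ) else 1) ≤ 1 := by
      intro x i
      exact sum_mul_le_of_le hQ fun N => by split_ifs <;> norm_num
    -- Sending the bin of a covering codeword fails only if the noise takes the difference out of T,
    -- or if another codeword of that bin also passes the test.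
    have hcov : ∀ x a, x - c a ∈ S →
        ∑ N, Q N * (if x - dec a.1 (x + N) ∈ S then (0 : ℝ) else 1) ≤ bad x c a := by
      rintro x ⟨i, j⟩ ha
      have h1 := hST _ ha
      simp only [hbad]
      rw [Finset.sum_comm]
      refine le_trans ?_ (add_le_add_left h1 _)
      rw [← Finset.sum_add_distrib]
      refine Finset.sum_le_sum fun N _ => ?_
      rw [← Finset.mul_sum, ← mul_add]
      refine mul_le_mul_of_nonneg_left ?_ (hQ.nonneg N)
      have hs0 : (0 : ℝ) ≤ ∑ j' ∈ Finset.univ.erase j,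
          (if x + N - c (i, j') ∈ T then (1 : ℝ) else 0) :=
        Finset.sum_nonneg fun j' _ => by split_ifs <;> norm_num
      have e : x - c (i, j) + N = x + N - c (i, j) := by abel
      rw [e]
      by_cases hT : x + N - c (i, j) ∈ T
      · by_cases hall : ∀ j', j' ≠ j → x + N - c (i, j') ∉ T
        · rw [hdec i j _ hT hall, if_pos ha, if_pos hT]
          simp
        · push Not at hall
          obtain ⟨j', hj', hj'T⟩ := hall
          have : (1 : ℝ) ≤ ∑ j' ∈ Finset.univ.erase j,
              (if x + N - c (i, j') ∈ T then (1 : ℝ) else 0) := by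
            refine le_trans ?_ (Finset.single_le_sum (f := fun j' =>
              (if x + N - c (i, j') ∈ T then (1 : ℝ) else 0)) (fun j' _ => by
                split_ifs <;> norm_num) (Finset.mem_erase.2 ⟨hj', Finset.mem_univ _⟩))
            simp [hj'T]
          split_ifs <;> linarith
      · rw [if_neg hT]
        split_ifs <;> linarith
    have hex : ∀ x, ∃ i, ∑ N, Q N * (if x - dec i (x + N) ∈ S then (0 : ℝ) else 1) ≤ A x c := by
      intro x
      have hsum0 : 0 ≤ ∑ a, ind x c a * bad x c a :=
        Finset.sum_nonneg fun a _ => mul_nonneg (hind0 x c a) (hbad0 x c a)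
      have hcard : (Fintype.card (I × J) : ℝ) = L := by simp [hL]
      have hdev : ∑ a, (ind x c a - p) = ∑ a, ind x c a - μ := by
        rw [Finset.sum_sub_distrib, Finset.sum_const, Finset.card_univ, nsmul_eq_mul, hcard]
      by_cases hN : ∑ a, ind x c a < μ / 2
      · refine ⟨Classical.arbitrary I, (hle1 x _).trans ?_⟩
        have h1 : (μ / 2) ^ 2 ≤ (∑ a, (ind x c a - p)) ^ 2 := by
          rw [hdev]; nlinarith
        have h2 : 1 = (4 / μ ^ 2) * (μ / 2) ^ 2 := by field_simp; norm_num
        have h3 : 0 ≤ (2 / μ) * ∑ a, ind x c a * bad x c a := by positivity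
        have h4 : (4 / μ ^ 2) * (μ / 2) ^ 2 ≤ (4 / μ ^ 2) * (∑ a, (ind x c a - p)) ^ 2 := by
          gcongr
        simp only [hA]; linarith
      · push Not at hN
        -- If every bin failed with probability above A, every covering codeword would have `bad`
        -- above A. Summing over at least μ/2 of them contradicts the second term of A.
        by_contra! hc
        have hA0 : 0 ≤ (4 / μ ^ 2) * (∑ a, (ind x c a - p)) ^ 2 := by positivity
        have h1 : ∀ a, ind x c a * A x c ≤ ind x c a * bad x c a := by
          intro a
          by_cases ha : x - c a ∈ S
          · exact mul_le_mul_of_nonneg_left ((hc a.1).le.trans (hcov x a ha)) (hind0 x c a)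
          · simp [hind, ha]
        have hpos : 0 < ∑ a, ind x c a := lt_of_lt_of_le (by positivity) hN
        have h2 : ∑ a, ind x c a * A x c < ∑ a, ind x c a * bad x c a := by
          obtain ⟨a, -, ha⟩ : ∃ a ∈ Finset.univ, 0 < ind x c a :=
            Finset.exists_lt_of_sum_lt (by simp [hpos])
          have haS : x - c a ∈ S := by
            by_contra h
            simp [hind, h] at ha
          exact Finset.sum_lt_sum (fun a _ => h1 a) ⟨a, Finset.mem_univ a,
            mul_lt_mul_of_pos_left ((hc a.1).trans_le (hcov x a haS)) ha⟩
        rw [← Finset.sum_mul] at h2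
        have hAnn : 0 ≤ A x c := by simp only [hA]; positivity
        have h3 : μ / 2 * A x c ≤ (∑ a, ind x c a) * A x c := by gcongr
        have h4 : (2 / μ) * (μ / 2 * A x c) < (2 / μ) * ∑ a, ind x c a * bad x c a := by
          have := h3.trans_lt h2
          gcongr
        have h5 : (2 / μ) * (μ / 2 * A x c) = A x c := by field_simp
        rw [h5] at h4
        simp only [hA] at h4 hA0
        linarith
    choose enc henc using hex
    exact ⟨enc, dec, henc⟩
  -- the average over codebooks
  have hmean : ∀ x, iidMean U (A x) ≤ 4 * Fintype.card G / (Fintype.card I * Fintype.card J * S.card)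
          + 2 * (ε + (Fintype.card J - 1) * T.card / Fintype.card G) := by
    intro x
    have hSx : ∑ g, U g * (if x - g ∈ S then 1 else 0) = p := sum_indicator_sub_mem S x
    have e1 : iidMean U (fun c : I × J → G => (∑ a, (ind x c a - p)) ^ 2) ≤ L * p := by
      have h0 : ∑ g, U g * ((if x - g ∈ S then 1 else 0) - p) = 0 := by
        simp only [mul_sub, Finset.sum_sub_distrib, hSx, ← Finset.sum_mul, hUp.sum_eq_one]
        ring
      have := iidMean_sq_sum (ι := I × J) hUp (fun g => (if x - g ∈ S then 1 else 0) - p) h0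
      simp only [hind]
      rw [this, Fintype.card_prod, Nat.cast_mul]
      refine mul_le_mul_of_nonneg_left ?_ hL0.le
      have e2 : ∀ g, U g * ((if x - g ∈ S then (1 : ℝ) else 0) - p) ^ 2
          = (1 - 2 * p) * (U g * (if x - g ∈ S then 1 else 0)) + U g * p ^ 2 := fun g => by
        split_ifs <;> ring
      simp only [e2, Finset.sum_add_distrib, ← Finset.mul_sum, ← Finset.sum_mul, hSx,
        hUp.sum_eq_one]
      nlinarith [sq_nonneg p]
    have e3 : ∀ a : I × J, iidMean U (fun c => ind x c a * bad x c a)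
        = p * (ε + (Fintype.card J - 1) * T.card / Fintype.card G) := by
      rintro ⟨i, j⟩
      have h1 : ∀ c : I × J → G, ind x c (i, j) * bad x c (i, j) = ε * ind x c (i, j)
          + ∑ j' ∈ Finset.univ.erase j, ∑ N, Q N *
            (ind x c (i, j) * (if x + N - c (i, j') ∈ T then 1 else 0)) := by
        intro c
        simp only [hbad, mul_add, Finset.mul_sum]
        congr 1
        · ring
        · refine Finset.sum_congr rfl fun j' _ => Finset.sum_congr rfl fun N _ => by ring
      simp only [h1]
      rw [iidMean_add, iidMean_mul_left, iidMean_sum]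
      have h2 : iidMean U (fun c : I × J → G => ind x c (i, j)) = p := by
        rw [← hSx]
        exact iidMean_apply hUp (i, j) fun g => if x - g ∈ S then 1 else 0
      have h3 : ∀ j' ∈ Finset.univ.erase j, iidMean U (fun c : I × J → G => ∑ N, Q N *
            (ind x c (i, j) * (if x + N - c (i, j') ∈ T then 1 else 0)))
            = p * (T.card / Fintype.card G) := by
        intro j' hj'
        have hne : (i, j) ≠ (i, j') := by
          intro h
          simp only [Prod.mk.injEq, true_and] at h
          simp [h] at hj'
        rw [iidMean_sum]
        have h4 : ∀ N, iidMean U (fun c : I × J → G => Q N *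
            (ind x c (i, j) * (if x + N - c (i, j') ∈ T then 1 else 0)))
            = Q N * (p * (T.card / Fintype.card G)) := by
          intro N
          rw [iidMean_mul_left]
          congr 1
          have := iidMean_apply_mul_apply hUp hne (fun g => if x - g ∈ S then (1 : ℝ) else 0)
            (fun g => if x + N - g ∈ T then (1 : ℝ) else 0)
          rw [hSx] at this
          rw [← sum_indicator_sub_mem T (x + N)]
          exact this
        simp only [h4, ← Finset.sum_mul, hQ.sum_eq_one, one_mul]
      rw [Finset.sum_congr rfl h3, h2, Finset.sum_const, Finset.card_erase_of_mem
        (Finset.mem_univ j), Finset.card_univ, nsmul_eq_mul,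
        Nat.cast_sub Fintype.card_pos, Nat.cast_one]
      ring
    simp only [hA]
    rw [iidMean_add, iidMean_mul_left, iidMean_mul_left, iidMean_sum,
      Finset.sum_congr rfl fun a _ => e3 a, Finset.sum_const, Finset.card_univ, nsmul_eq_mul,
      Fintype.card_prod, Nat.cast_mul]
    refine add_le_add ?_ (le_of_eq ?_)
    · calc (4 / μ ^ 2) * iidMean U (fun c : I × J → G => (∑ a, (ind x c a - p)) ^ 2)
          ≤ (4 / μ ^ 2) * (L * p) := by gcongr
        _ = _ := by
          simp only [hμ, hp, hL]; field_simp
    · rw [← hL, ← mul_assoc L, ← hμ]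
      field_simp
  have hfin : iidMean U (fun c : I × J → G => ∑ x, U x * A x c)
      ≤ 4 * Fintype.card G / (Fintype.card I * Fintype.card J * S.card)
          + 2 * (ε + (Fintype.card J - 1) * T.card / Fintype.card G) := by
    rw [iidMean_sum]
    simp only [iidMean_mul_left]
    refine (Finset.sum_le_sum fun x _ =>
      mul_le_mul_of_nonneg_left (hmean x) (hUp.nonneg x)).trans (le_of_eq ?_)
    rw [← Finset.sum_mul, hUp.sum_eq_one, one_mul]
  obtain ⟨c, hc⟩ := exists_le_of_iidMean_le hUp hfin
  obtain ⟨enc, dec, h⟩ := hcode c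
  exact ⟨enc, dec, (Finset.sum_le_sum fun x _ =>
    mul_le_mul_of_nonneg_left (h x) (hUp.nonneg x)).trans hc⟩

end OneShot

/-! ### One-shot superposition coding on a finite group -/

section OneShot

variable {G I J : Type*} [AddCommGroup G] [Fintype G] [DecidableEq G]
  [Fintype I] [Fintype J] [DecidableEq I] [DecidableEq J]

/-- Independent uniform cloud centres: the difference of two of them is uniform. -/
theorem iidMean_cloud [Nonempty G] (T : Finset G) {i i' : I} (h : i ≠ i') (e : G) :
    iidMean (fun _ : G => (1 / Fintype.card G : ℝ))
        (fun w : I → G => if w i + e - w i' ∈ T then 1 else 0) = T.card / Fintype.card G := by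
  rw [iidMean_apply_two isProb_uniform h (fun x y => if x + e - y ∈ T then 1 else 0)]
  simp only [sum_indicator_sub_mem]
  simp

/-- Random superposition coding on a finite group. The cloud centres are uniform, the satellites
have law `P`, and the noises have laws `Qb` and `Qg`. -/
theorem exists_superposition_code [Nonempty I] [Nonempty J] {P Qb Qg : G → ℝ} (hP : IsProb P)
    (hQb : IsProb Qb) (hQg : IsProb Qg) (Tb Tg Tn : Finset G) {ε η : ℝ}
    (hb : ∑ z, P z * ∑ N, Qb N * (if z + N ∈ Tb then 0 else 1) ≤ ε)
    (hg : ∑ z, P z * ∑ N, Qg N * (if z + N ∈ Tg then 0 else 1) ≤ ε)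
    (hn : ∑ N, Qg N * (if N ∈ Tn then 0 else 1) ≤ ε)
    (hη : ∑ z, P z * ∑ z', P z' * ∑ N, Qg N *
      (if z + N ∈ Tg ∧ z + N - z' ∈ Tn then 1 else 0) ≤ η) :
    ∃ (enc : I × J → G) (decB : G → I) (decG : G → I × J),
      ∑ a, (∑ N, Qb N * (if decB (enc a + N) = a.1 then 0 else 1)
          + ∑ N, Qg N * (if decG (enc a + N) = a then 0 else 1))
        ≤ Fintype.card I * Fintype.card J * (3 * ε
          + (Fintype.card I - 1) * (Tb.card + Tg.card) / Fintype.card G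
          + (Fintype.card J - 1) * η) := by
  classical
  set U : G → ℝ := fun _ => (1 / Fintype.card G : ℝ) with hU
  have hUp : IsProb U := isProb_uniform
  set bB : (I → G) → (I × J → G) → I × J → ℝ := fun w z a =>
    ∑ N, Qb N * (if z a + N ∈ Tb then 0 else 1)
      + ∑ i ∈ Finset.univ.erase a.1, ∑ N, Qb N * (if w a.1 + (z a + N) - w i ∈ Tb then 1 else 0)
    with hbB
  set bG : (I → G) → (I × J → G) → I × J → ℝ := fun w z a =>
    ∑ N, Qg N * (if z a + N ∈ Tg then 0 else 1) + ∑ N, Qg N * (if N ∈ Tn then 0 else 1)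
      + ∑ i ∈ Finset.univ.erase a.1, ∑ N, Qg N * (if w a.1 + (z a + N) - w i ∈ Tg then 1 else 0)
      + ∑ j ∈ Finset.univ.erase a.2, ∑ N, Qg N *
          (if z a + N ∈ Tg ∧ z a + N - z (a.1, j) ∈ Tn then 1 else 0)
    with hbG
  have hcode : ∀ (w : I → G) (z : I × J → G), ∃ (decB : G → I) (decG : G → I × J), ∀ a,
      ∑ N, Qb N * (if decB (w a.1 + z a + N) = a.1 then 0 else 1)
          + ∑ N, Qg N * (if decG (w a.1 + z a + N) = a then 0 else 1) ≤ bB w z a + bG w z a := by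
    intro w z
    obtain ⟨decB, hB⟩ := exists_decoder fun v i => v - w i ∈ Tb
    -- Receiver `g` decodes jointly: relative to the cloud centre the output must look like
    -- satellite plus noise, and relative to the codeword like noise.
    obtain ⟨decG, hG⟩ := exists_decoder fun v (a : I × J) => v - w a.1 ∈ Tg ∧ v - w a.1 - z a ∈ Tn
    refine ⟨decB, decG, fun a => add_le_add ?_ ?_⟩
    · simp only [hbB]
      rw [Finset.sum_comm, ← Finset.sum_add_distrib]
      refine Finset.sum_le_sum fun N _ => ?_
      rw [← Finset.mul_sum, ← mul_add]
      refine mul_le_mul_of_nonneg_left ?_ (hQb.nonneg N)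
      have hs0 := sum_indicator_nonneg (Finset.univ.erase a.1)
        fun i => w a.1 + (z a + N) - w i ∈ Tb
      by_cases h1 : z a + N ∈ Tb
      · by_cases h2 : ∃ i, i ≠ a.1 ∧ w a.1 + (z a + N) - w i ∈ Tb
        · obtain ⟨i, hi, hiT⟩ := h2
          have := one_le_sum_indicator (Finset.univ.erase a.1)
            (fun i => w a.1 + (z a + N) - w i ∈ Tb)
            (Finset.mem_erase.2 ⟨hi, Finset.mem_univ _⟩) hiT
          split_ifs <;> linarith
        · push Not at h2
          have := hB (w a.1 + z a + N) a.1
            (by simpa only [show w a.1 + z a + N - w a.1 = z a + N by abel] using h1)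
            (fun i hi => by rw [add_assoc]; exact h2 i hi)
          rw [if_pos this, if_pos h1]
          linarith
      · rw [if_neg h1]
        split_ifs <;> linarith
    · simp only [hbG]
      rw [Finset.sum_comm (s := Finset.univ.erase a.1), Finset.sum_comm (s := Finset.univ.erase a.2),
        ← Finset.sum_add_distrib, ← Finset.sum_add_distrib, ← Finset.sum_add_distrib]
      refine Finset.sum_le_sum fun N _ => ?_
      rw [← Finset.mul_sum, ← Finset.mul_sum, ← mul_add, ← mul_add, ← mul_add]
      refine mul_le_mul_of_nonneg_left ?_ (hQg.nonneg N)
      have hs0 := sum_indicator_nonneg (Finset.univ.erase a.1)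
        fun i => w a.1 + (z a + N) - w i ∈ Tg
      have hs1 := sum_indicator_nonneg (Finset.univ.erase a.2)
        fun j => z a + N ∈ Tg ∧ z a + N - z (a.1, j) ∈ Tn
      by_cases h1 : z a + N ∈ Tg
      · by_cases h0 : N ∈ Tn
        · by_cases h2 : ∃ i, i ≠ a.1 ∧ w a.1 + (z a + N) - w i ∈ Tg
          · obtain ⟨i, hi, hiT⟩ := h2
            have := one_le_sum_indicator (Finset.univ.erase a.1)
              (fun i => w a.1 + (z a + N) - w i ∈ Tg)
              (Finset.mem_erase.2 ⟨hi, Finset.mem_univ _⟩) hiT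
            rw [if_pos h1, if_pos h0]
            split_ifs <;> linarith
          · by_cases h3 : ∃ j, j ≠ a.2 ∧ (z a + N ∈ Tg ∧ z a + N - z (a.1, j) ∈ Tn)
            · obtain ⟨j, hj, hjT⟩ := h3
              have := one_le_sum_indicator (Finset.univ.erase a.2)
                (fun j => z a + N ∈ Tg ∧ z a + N - z (a.1, j) ∈ Tn)
                (Finset.mem_erase.2 ⟨hj, Finset.mem_univ _⟩) hjT
              rw [if_pos h1, if_pos h0]
              split_ifs <;> linarith
            · push Not at h2 h3
              have := hG (w a.1 + z a + N) a
                ⟨by simpa only [show w a.1 + z a + N - w a.1 = z a + N by abel] using h1,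
                  by simpa only [show w a.1 + z a + N - w a.1 - z a = N by abel] using h0⟩
                (by
                  rintro ⟨i, j⟩ hij ⟨t1, t2⟩
                  -- For a wrong cloud the first test already fails, whatever j is. The union bound
                  -- thus runs over clouds rather than over message pairs.
                  by_cases hi : i = a.1
                  · subst hi
                    have hj : j ≠ a.2 := fun h => hij (by rw [h])
                    refine h3 j hj h1 ?_
                    simpa only [show w a.1 + z a + N - w a.1 - z (a.1, j)
                      = z a + N - z (a.1, j) by abel] using t2
                  · exact h2 i hi (by rw [← add_assoc]; exact t1))
              rw [if_pos this, if_pos h1, if_pos h0]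
              linarith
        · rw [if_neg h0, if_pos h1]
          split_ifs <;> linarith
      · rw [if_neg h1]
        split_ifs <;> linarith
  have hcardI : ∀ i : I, ((Finset.univ.erase i).card : ℝ) = Fintype.card I - 1 := fun i => by
    rw [Finset.card_erase_of_mem (Finset.mem_univ i), Finset.card_univ,
      Nat.cast_sub Fintype.card_pos, Nat.cast_one]
  have hcardJ : ∀ j : J, ((Finset.univ.erase j).card : ℝ) = Fintype.card J - 1 := fun j => by
    rw [Finset.card_erase_of_mem (Finset.mem_univ j), Finset.card_univ,
      Nat.cast_sub Fintype.card_pos, Nat.cast_one]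
  have hcloud : ∀ {Q : G → ℝ} (_ : IsProb Q) (T : Finset G) (a : I × J), iidMean P (fun z : I × J → G =>
      iidMean U fun w : I → G => ∑ i ∈ Finset.univ.erase a.1,
        ∑ N, Q N * (if w a.1 + (z a + N) - w i ∈ T then 1 else 0))
      = (Fintype.card I - 1) * (T.card / Fintype.card G) := by
    intro Q hQ T a
    have h1 : ∀ z : I × J → G, iidMean U (fun w : I → G => ∑ i ∈ Finset.univ.erase a.1,
        ∑ N, Q N * (if w a.1 + (z a + N) - w i ∈ T then 1 else 0))
        = (Fintype.card I - 1) * (T.card / Fintype.card G) := by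
      intro z
      rw [iidMean_sum]
      have h2 : ∀ i ∈ Finset.univ.erase a.1, iidMean U (fun w : I → G =>
          ∑ N, Q N * (if w a.1 + (z a + N) - w i ∈ T then 1 else 0))
          = T.card / Fintype.card G := by
        intro i hi
        rw [iidMean_sum]
        simp only [iidMean_mul_left]
        have h3 : ∀ N, iidMean U (fun w : I → G =>
            if w a.1 + (z a + N) - w i ∈ T then (1 : ℝ) else 0) = T.card / Fintype.card G :=
          fun N => iidMean_cloud T (Finset.ne_of_mem_erase hi).symm _
        simp only [h3, ← Finset.sum_mul, hQ.sum_eq_one, one_mul]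
      rw [Finset.sum_congr rfl h2, Finset.sum_const, nsmul_eq_mul, hcardI]
    simp only [h1]
    exact iidMean_const hP _
  have hmean : ∀ a, iidMean P (fun z => iidMean U fun w => bB w z a + bG w z a)
      ≤ 3 * ε + (Fintype.card I - 1) * (Tb.card + Tg.card) / Fintype.card G
          + (Fintype.card J - 1) * η := by
    intro a
    simp only [hbB, hbG, iidMean_add, iidMean_const hUp, iidMean_const hP]
    rw [hcloud hQb, hcloud hQg]
    have h1 := iidMean_apply hP a (fun z => ∑ N, Qb N * (if z + N ∈ Tb then (0 : ℝ) else 1))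
    have h2 := iidMean_apply hP a (fun z => ∑ N, Qg N * (if z + N ∈ Tg then (0 : ℝ) else 1))
    have h3 : iidMean P (fun z : I × J → G => ∑ j ∈ Finset.univ.erase a.2, ∑ N, Qg N *
          (if z a + N ∈ Tg ∧ z a + N - z (a.1, j) ∈ Tn then 1 else 0))
          ≤ (Fintype.card J - 1) * η := by
      rw [iidMean_sum, ← hcardJ a.2, ← nsmul_eq_mul, ← Finset.sum_const]
      refine Finset.sum_le_sum fun j hj => ?_
      have hne : a ≠ (a.1, j) := fun h => Finset.ne_of_mem_erase hj (by rw [h])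
      have h4 := iidMean_apply_two hP hne (fun z z' => ∑ N, Qg N *
          (if z + N ∈ Tg ∧ z + N - z' ∈ Tn then (1 : ℝ) else 0))
      rw [h4]
      exact hη
    rw [h1, h2]
    have : (Fintype.card I - 1) * (Tb.card / Fintype.card G : ℝ)
        + (Fintype.card I - 1) * (Tg.card / Fintype.card G : ℝ)
        = (Fintype.card I - 1) * (Tb.card + Tg.card) / Fintype.card G := by ring
    linarith
  have hfin : iidMean P (fun z : I × J → G => iidMean U fun w => ∑ a, (bB w z a + bG w z a))
      ≤ Fintype.card I * Fintype.card J * (3 * ε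
          + (Fintype.card I - 1) * (Tb.card + Tg.card) / Fintype.card G
          + (Fintype.card J - 1) * η) := by
    simp only [iidMean_sum]
    refine (Finset.sum_le_sum fun a _ => hmean a).trans (le_of_eq ?_)
    rw [Finset.sum_const, Finset.card_univ, nsmul_eq_mul, Fintype.card_prod, Nat.cast_mul]
  obtain ⟨z, hz⟩ := exists_le_of_iidMean_le hP hfin
  obtain ⟨w, hw⟩ := exists_le_of_iidMean_le hUp hz
  obtain ⟨decB, decG, h⟩ := hcode w z
  exact ⟨fun a => w a.1 + z a, decB, decG, (Finset.sum_le_sum fun a _ => h a).trans hw⟩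

end OneShot

/-! ### Bernoulli words -/

/-- The law `Ber(p)` on `Bool`. -/
noncomputable def bern (p : ℝ) (b : Bool) : ℝ := if b then p else 1 - p

/-- The law of an i.i.d. `Ber(p)` word. -/
noncomputable def wordLaw (p : ℝ) {k : ℕ} (e : Fin k → Bool) : ℝ := ∏ i, bern p (e i)

/-- The Hamming weight of a word. -/
noncomputable def weight {k : ℕ} (e : Fin k → Bool) : ℝ := ∑ i, if e i then 1 else 0

theorem isProb_bern {p : ℝ} (hp : p ∈ Set.Icc (0 : ℝ) 1) : IsProb (bern p) where
  nonneg b := by cases b <;> simp [bern, hp.1, hp.2]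
  sum_eq_one := by simp [bern]

theorem isProb_wordLaw {p : ℝ} (hp : p ∈ Set.Icc (0 : ℝ) 1) (k : ℕ) :
    IsProb (wordLaw p : (Fin k → Bool) → ℝ) :=
  (isProb_bern hp).iid

theorem bscWord_eq (p : ℝ) {k : ℕ} (a b : Fin k → Bool) : bscWord p a b = wordLaw p (b - a) := by
  refine Finset.prod_congr rfl fun i _ => ?_
  rw [Pi.sub_apply]
  cases a i <;> cases b i <;> rfl

theorem sum_bscWord_mul (p : ℝ) {k : ℕ} (u : Fin k → Bool) (F : (Fin k → Bool) → ℝ) :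
    ∑ v, bscWord p u v * F v = ∑ N, wordLaw p N * F (u + N) := by
  simp only [bscWord_eq]
  rw [← Equiv.sum_comp (Equiv.addLeft u)]
  simp

theorem weight_sub {k : ℕ} (x z : Fin k → Bool) : weight (x - z) = hammingDist x z := by
  rw [hammingDist, Finset.card_filter, Nat.cast_sum]
  refine Finset.sum_congr rfl fun i _ => ?_
  rw [Pi.sub_apply]
  cases x i <;> cases z i <;> simp

theorem bern_conv (a b : ℝ) (e : Bool) :
    ∑ z, bern a z * bern b (e - z) = bern (binConv a b) e := by
  have h1 : (false - true : Bool) = true := rfl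
  have h2 : (true - true : Bool) = false := rfl
  have h3 : (false - false : Bool) = false := rfl
  have h4 : (true - false : Bool) = true := rfl
  cases e <;> simp only [Fintype.sum_bool, h1, h2, h3, h4, bern, binConv] <;> simp <;> ring

/-- Addition on `Bool` is exclusive or, so the sum of independent Ber(a) and Ber(b) words is a
Ber(a⋆b) word; letter by letter this is `bern_conv`. -/
theorem sum_wordLaw_conv (a b : ℝ) {k : ℕ} (F : (Fin k → Bool) → ℝ) :
    ∑ z, wordLaw a z * ∑ N, wordLaw b N * F (z + N) = ∑ e, wordLaw (binConv a b) e * F e := by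
  have h1 : ∀ z : Fin k → Bool, ∑ N, wordLaw b N * F (z + N) = ∑ e, wordLaw b (e - z) * F e :=
    fun z => by
      rw [← Equiv.sum_comp (Equiv.addLeft z) (fun e => wordLaw b (e - z) * F e)]
      simp
  simp only [h1, Finset.mul_sum]
  rw [Finset.sum_comm]
  refine Finset.sum_congr rfl fun e _ => ?_
  simp only [← mul_assoc, ← Finset.sum_mul]
  congr 1
  simp only [wordLaw, Pi.sub_apply, ← bern_conv a b]
  rw [Finset.prod_univ_sum, Fintype.piFinset_univ]
  simp only [Finset.prod_mul_distrib]

theorem binConv_mem {a b : ℝ} (ha : a ∈ Set.Icc (0 : ℝ) 1) (hb : b ∈ Set.Icc (0 : ℝ) 1) :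
    binConv a b ∈ Set.Icc (0 : ℝ) 1 := by
  obtain ⟨a0, a1⟩ := ha
  obtain ⟨b0, b1⟩ := hb
  constructor <;> simp only [binConv] <;>
    nlinarith [mul_nonneg a0 b0, mul_nonneg a0 (sub_nonneg.2 b1), mul_nonneg (sub_nonneg.2 a1) b0,
      mul_nonneg (sub_nonneg.2 a1) (sub_nonneg.2 b1)]

/-! ### Binary entropy -/

/-- Symmetry about 1/2 makes the entropy a function of |1 − 2s|, strictly decreasing on [0,1] in
that variable. All entropy comparisons below go through it, because ⋆ becomes multiplication in the
variable 1 − 2s. -/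
theorem H2_eq_fold (s : ℝ) : H2 s = H2 ((1 - |1 - 2 * s|) / 2) := by
  rcases abs_cases (1 - 2 * s) with ⟨h, -⟩ | ⟨h, -⟩ <;> rw [h]
  · congr 1; ring
  · rw [show (1 - -(1 - 2 * s)) / 2 = 1 - s by ring, H2, H2, Real.binEntropy_one_sub]

theorem H2_lt_of_abs {s t : ℝ} (ht : t ∈ Set.Icc (0 : ℝ) 1) (h : |1 - 2 * s| < |1 - 2 * t|) :
    H2 t < H2 s := by
  have h1 : |1 - 2 * t| ≤ 1 := abs_le.2 ⟨by linarith [ht.2], by linarith [ht.1]⟩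
  rw [H2_eq_fold s, H2_eq_fold t]
  refine div_lt_div_of_pos_right (Real.binEntropy_strictMonoOn ?_ ?_ ?_) (Real.log_pos one_lt_two)
  · constructor <;> linarith [abs_nonneg (1 - 2 * t)]
  · constructor <;> linarith [abs_nonneg (1 - 2 * s)]
  · linarith

theorem H2_le_of_abs {s t : ℝ} (ht : t ∈ Set.Icc (0 : ℝ) 1) (h : |1 - 2 * s| ≤ |1 - 2 * t|) :
    H2 t ≤ H2 s := by
  rcases h.lt_or_eq with h | h
  · exact (H2_lt_of_abs ht h).le
  · rw [H2_eq_fold s, H2_eq_fold t, h]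

theorem one_sub_two_mul_binConv (a b : ℝ) :
    1 - 2 * binConv a b = (1 - 2 * a) * (1 - 2 * b) := by
  simp only [binConv]; ring

theorem r_nonneg {a b : ℝ} (ha : a ∈ Set.Icc (0 : ℝ) 1) (hb : b ∈ Set.Icc (0 : ℝ) 1) :
    0 ≤ r a b := by
  refine sub_nonneg.2 (H2_le_of_abs ha ?_)
  rw [one_sub_two_mul_binConv, abs_mul]
  exact mul_le_of_le_one_right (abs_nonneg _)
    (abs_le.2 ⟨by linarith [hb.2], by linarith [hb.1]⟩)

theorem r_pos {a b : ℝ} (ha : a ∈ Set.Ico (0 : ℝ) (1 / 2)) (hb : b ∈ Set.Ioo (0 : ℝ) 1) :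
    0 < r a b := by
  refine sub_pos.2 (H2_lt_of_abs ⟨ha.1, by linarith [ha.2]⟩ ?_)
  rw [one_sub_two_mul_binConv, abs_mul]
  refine mul_lt_of_lt_one_right (abs_pos.2 (by linarith [ha.2])) ?_
  exact abs_lt.2 ⟨by linarith [hb.2], by linarith [hb.1]⟩

/-- Subtracting the degradation identities for the two inputs gives 1 − 2b = (1 − 2a)(K(0,0) −
K(1,0)), and the last factor is a difference of two probabilities. -/
theorem IsDegraded.abs_le {a b : ℝ} (h : IsDegraded a b) : |1 - 2 * b| ≤ |1 - 2 * a| := by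
  obtain ⟨K, h0, h1, h2⟩ := h
  have e1 := h2 false false
  have e2 := h2 true false
  have s1 := h1 false
  have s2 := h1 true
  simp only [bsc, Fintype.sum_bool] at e1 e2 s1 s2
  simp at e1 e2
  have e : 1 - 2 * b = (1 - 2 * a) * (K false false - K true false) := by linear_combination e1 - e2
  rw [e, abs_mul]
  refine mul_le_of_le_one_right (abs_nonneg _) (_root_.abs_le.2 ⟨?_, ?_⟩) <;>
    linarith [h0 false false, h0 false true, h0 true false, h0 true true]

theorem IsDegraded.H2_binConv_le {a b : ℝ} (h : IsDegraded a b) {s : ℝ}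
    (hs : s ∈ Set.Icc (0 : ℝ) 1) (ha : a ∈ Set.Icc (0 : ℝ) 1) :
    H2 (binConv s a) ≤ H2 (binConv s b) := by
  refine H2_le_of_abs (binConv_mem hs ha) ?_
  rw [one_sub_two_mul_binConv, one_sub_two_mul_binConv, abs_mul, abs_mul]
  exact mul_le_mul_of_nonneg_left h.abs_le (abs_nonneg _)

/-! ### Typical words -/

theorem sum_bern_mul_logb (s : ℝ) : ∑ b, bern s b * -Real.logb 2 (bern s b) = H2 s := by
  simp only [Fintype.sum_bool, bern, H2, Real.binEntropy, Real.logb, Real.log_inv]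
  simp
  ring

/-- Asymptotic equipartition for i.i.d. `Ber(s)` words. -/
theorem exists_typical {s : ℝ} (hs : s ∈ Set.Icc (0 : ℝ) 1) {ε δ : ℝ} (hε : 0 < ε) (hδ : 0 < δ) :
    ∃ k₀ : ℕ, ∀ k : ℕ, k₀ ≤ k → ∃ T : Finset (Fin k → Bool),
      ∑ e, wordLaw s e * (if e ∈ T then 0 else 1) ≤ ε ∧
      ∀ e ∈ T, (2 : ℝ) ^ (-(k * (H2 s + δ))) ≤ wordLaw s e ∧
        wordLaw s e ≤ (2 : ℝ) ^ (-(k * (H2 s - δ))) ∧ weight e ≤ k * (s + δ) := by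
  classical
  set f : Bool → ℝ := fun b => -Real.logb 2 (bern s b) with hf
  set g : Bool → ℝ := fun b => if b then 1 else 0 with hg
  set C : ℝ := ∑ b, bern s b * f b ^ 2 + ∑ b, bern s b * g b ^ 2 with hC
  have hB := isProb_bern hs
  have hgs : ∑ b, bern s b * g b = s := by simp [hg, bern]
  have hfs : ∑ b, bern s b * f b = H2 s := sum_bern_mul_logb s
  obtain ⟨k₁, hk₁⟩ := exists_nat_gt (C / (ε * δ ^ 2))
  refine ⟨k₁ + 1, fun k hk => ?_⟩
  have hk0 : (0 : ℝ) < k := by exact_mod_cast (by omega : 0 < k)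
  have hkk : C ≤ k * (ε * δ ^ 2) := by
    rw [← div_le_iff₀ (by positivity)]
    exact hk₁.le.trans (by exact_mod_cast (by omega : k₁ ≤ k))
  set pf : (Fin k → Bool) → Prop := fun e => k * δ ≤ |∑ i, f (e i) - k * H2 s| with hpf
  set pg : (Fin k → Bool) → Prop := fun e => k * δ ≤ |∑ i, g (e i) - k * s| with hpg
  have hdf := iidMean_deviation_le (ι := Fin k) hB f (t := k * δ) (by positivity)
  have hdg := iidMean_deviation_le (ι := Fin k) hB g (t := k * δ) (by positivity)
  rw [hfs, Fintype.card_fin] at hdf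
  rw [hgs, Fintype.card_fin] at hdg
  -- Since `Real.logb 2 0 = 0`, a letter of probability zero has information 0 here, and a null word
  -- could pass the deviation tests. Such words are excluded explicitly, which costs no probability.
  refine ⟨Finset.univ.filter fun e => wordLaw s e ≠ 0 ∧ ¬ pf e ∧ ¬ pg e, ?_, ?_⟩
  · have h1 : ∑ e : Fin k → Bool, wordLaw s e *
        (if e ∈ Finset.univ.filter (fun e => wordLaw s e ≠ 0 ∧ ¬ pf e ∧ ¬ pg e) then 0 else 1)
        ≤ iidMean (bern s) (fun e : Fin k → Bool => if pf e then 1 else 0)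
          + iidMean (bern s) (fun e : Fin k → Bool => if pg e then 1 else 0) := by
      rw [← iidMean_add]
      refine Finset.sum_le_sum fun e _ => ?_
      change wordLaw s e * _ ≤ wordLaw s e * _
      have h0 : 0 ≤ wordLaw s e := (isProb_wordLaw hs k).nonneg e
      by_cases h : wordLaw s e = 0
      · simp [h]
      · refine mul_le_mul_of_nonneg_left ?_ h0
        by_cases h1 : pf e <;> by_cases h2 : pg e <;> simp [h, h1, h2]
    refine h1.trans ((add_le_add hdf hdg).trans ?_)
    have h2 : k * (∑ b, bern s b * f b ^ 2) / (k * δ) ^ 2 + k * (∑ b, bern s b * g b ^ 2) / (k * δ) ^ 2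
        = C / (k * δ ^ 2) := by
      rw [hC]; field_simp
    rw [h2, div_le_iff₀ (by positivity)]
    linarith
  · intro e he
    obtain ⟨h0, h1, h2⟩ := (Finset.mem_filter.1 he).2
    simp only [hpf, hpg, not_le, abs_lt] at h1 h2
    have hpos : 0 < wordLaw s e := lt_of_le_of_ne ((isProb_wordLaw hs k).nonneg e) (Ne.symm h0)
    have hlog : Real.logb 2 (wordLaw s e) = -∑ i, f (e i) := by
      rw [wordLaw, Real.logb_prod]
      · simp [hf]
      · intro i _ hi
        exact h0 (Finset.prod_eq_zero (Finset.mem_univ i) hi)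
    refine ⟨?_, ?_, ?_⟩
    · rw [← Real.le_logb_iff_rpow_le one_lt_two hpos, hlog]
      linarith [h1.2]
    · rw [← Real.logb_le_iff_le_rpow one_lt_two hpos, hlog]
      linarith [h1.1]
    · have : weight e = ∑ i, g (e i) := rfl
      rw [this]
      linarith [h2.2]

theorem card_le_of_prob_ge {G : Type*} [Fintype G] {P : G → ℝ} (hP : IsProb P) {T : Finset G}
    {a : ℝ} (h : ∀ e ∈ T, (2 : ℝ) ^ (-a) ≤ P e) : (T.card : ℝ) ≤ 2 ^ a := by
  have h1 : (T.card : ℝ) * 2 ^ (-a) ≤ 1 := by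
    rw [← nsmul_eq_mul, ← Finset.sum_const, ← hP.sum_eq_one]
    exact (Finset.sum_le_sum h).trans
      (Finset.sum_le_sum_of_subset_of_nonneg (Finset.subset_univ T) fun x _ _ => hP.nonneg x)
  have h2 : (0 : ℝ) < 2 ^ a := Real.rpow_pos_of_pos two_pos a
  rw [Real.rpow_neg two_pos.le, ← div_eq_mul_inv, div_le_one h2] at h1
  exact h1

theorem le_card_of_prob_le {G : Type*} [Fintype G] [DecidableEq G] {P : G → ℝ} (hP : IsProb P)
    {S : Finset G} {a c : ℝ} (hS : ∑ e, P e * (if e ∈ S then 0 else 1) ≤ c)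
    (h : ∀ e ∈ S, P e ≤ (2 : ℝ) ^ (-a)) : (1 - c) * 2 ^ a ≤ S.card := by
  have h1 : 1 - c ≤ (S.card : ℝ) * 2 ^ (-a) := by
    rw [← nsmul_eq_mul, ← Finset.sum_const]
    refine le_trans ?_ (Finset.sum_le_sum h)
    have h3 : ∑ e, P e * (if e ∈ S then (0 : ℝ) else 1) + ∑ e ∈ S, P e = 1 := by
      have h4 : ∑ e ∈ S, P e = ∑ e, P e * (if e ∈ S then (1 : ℝ) else 0) := by simp
      rw [h4, ← Finset.sum_add_distrib]
      refine Eq.trans ?_ hP.sum_eq_one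
      exact Finset.sum_congr rfl fun e _ => by split_ifs <;> ring
    linarith
  have h2 : (0 : ℝ) < 2 ^ a := Real.rpow_pos_of_pos two_pos a
  rw [Real.rpow_neg two_pos.le, ← div_eq_mul_inv, le_div_iff₀ h2] at h1
  exact h1

/-! ### Wyner-Ziv coding of a block -/

theorem exists_rpow_neg_le {δ η : ℝ} (hδ : 0 < δ) (hη : 0 < η) :
    ∃ k₀ : ℕ, ∀ k : ℕ, k₀ ≤ k → (2 : ℝ) ^ (-(k * δ)) ≤ η := by
  have h1 : (2 : ℝ) ^ (-δ) < 1 := Real.rpow_lt_one_of_one_lt_of_neg one_lt_two (by linarith)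
  have h0 : (0 : ℝ) ≤ 2 ^ (-δ) := Real.rpow_nonneg two_pos.le _
  obtain ⟨k₀, hk₀⟩ := exists_pow_lt_of_lt_one hη h1
  refine ⟨k₀, fun k hk => ?_⟩
  rw [show -(k * δ) = -δ * k by ring, Real.rpow_mul two_pos.le, Real.rpow_natCast]
  exact (pow_le_pow_of_le_one h0 h1.le hk).trans hk₀.le

/-- A positive integer close to `2 ^ x`. -/
noncomputable def expSize (x : ℝ) : ℕ := ⌊(2 : ℝ) ^ x⌋₊ + 1

theorem expSize_pos (x : ℝ) : 0 < expSize x := Nat.succ_pos _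

theorem rpow_le_expSize (x : ℝ) : (2 : ℝ) ^ x ≤ expSize x := by
  rw [expSize, Nat.cast_add, Nat.cast_one]
  exact (Nat.lt_floor_add_one _).le

theorem expSize_sub_one_le (x : ℝ) : (expSize x : ℝ) - 1 ≤ 2 ^ x := by
  rw [expSize, Nat.cast_add, Nat.cast_one, add_sub_cancel_right]
  exact Nat.floor_le (Real.rpow_nonneg two_pos.le _)

theorem le_logb_expSize (x : ℝ) : x ≤ Real.logb 2 (expSize x) := by
  rw [Real.le_logb_iff_rpow_le one_lt_two (by exact_mod_cast expSize_pos x)]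
  exact rpow_le_expSize x

theorem card_words (k : ℕ) : (Fintype.card (Fin k → Bool) : ℝ) = 2 ^ (k : ℝ) := by
  simp

theorem weight_le {k : ℕ} (e : Fin k → Bool) : weight e ≤ k := by
  have : weight e ≤ ∑ _i : Fin k, (1 : ℝ) :=
    Finset.sum_le_sum fun i _ => by split_ifs <;> norm_num
  simpa using this

/-- Wyner-Ziv coding of a block of `k` uniform bits with side information of crossover `β`. -/
theorem exists_block_code {α β : ℝ} (hα : α ∈ Set.Icc (0 : ℝ) 1) (hβ : β ∈ Set.Icc (0 : ℝ) 1)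
    {ε : ℝ} (hε : 0 < ε) :
    ∃ k₀ : ℕ, ∀ k : ℕ, k₀ ≤ k → ∀ M : ℕ, 0 < M → k * (r α β + ε) ≤ Real.logb 2 M →
      ∃ (enc : (Fin k → Bool) → Fin M) (dec : Fin M → (Fin k → Bool) → (Fin k → Bool)),
        ∑ x : Fin k → Bool, (1 / 2 : ℝ) ^ k *
          ∑ N, wordLaw β N * (hammingDist x (dec (enc x) (x + N)) : ℝ) ≤ k * (α + ε) := by
  classical
  -- The budget is 8δ. The failure probability is at most 8·δ/10 + 2(δ + δ/10) = 3δ, so the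
  -- distortion exceeds α by at most 4δ. The rate margin covers the 3δ of slack in the codebook
  -- exponents and leaves a decay of 2^(−kδ).
  set δ := ε / 8 with hδ
  have hδ0 : 0 < δ := by positivity
  have hγ := binConv_mem hα hβ
  set γ := binConv α β with hγd
  obtain ⟨k₁, hk₁⟩ := exists_typical hα (ε := 1 / 4) (by norm_num) hδ0
  obtain ⟨k₂, hk₂⟩ := exists_typical hγ (ε := δ / 4) (by positivity) hδ0
  obtain ⟨k₃, hk₃⟩ := exists_rpow_neg_le hδ0 (η := δ / 10) (by positivity)
  refine ⟨max k₁ (max k₂ k₃), fun k hk M hM hMr => ?_⟩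
  obtain ⟨A, hA, hAt⟩ := hk₁ k (le_trans (le_max_left _ _) hk)
  obtain ⟨T, hT, hTt⟩ := hk₂ k (le_trans ((le_max_left _ _).trans (le_max_right _ _)) hk)
  have hsmall := hk₃ k (le_trans ((le_max_right _ _).trans (le_max_right _ _)) hk)
  have hPα := isProb_wordLaw hα k
  have hPβ := isProb_wordLaw hβ k
  set miss : (Fin k → Bool) → ℝ := fun e => ∑ N, wordLaw β N * (if e + N ∈ T then 0 else 1)
    with hmiss
  have hmiss0 : ∀ e, 0 ≤ miss e := fun e => Finset.sum_nonneg fun N _ =>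
    mul_nonneg (hPβ.nonneg N) (by split_ifs <;> norm_num)
  have hmissavg : ∑ e, wordLaw α e * miss e ≤ δ / 4 := by
    simp only [hmiss]
    rw [sum_wordLaw_conv α β fun e => if e ∈ T then (0 : ℝ) else 1]
    exact hT
  -- Binning needs the passage from S to T to succeed for every e in S, whereas typicality gives
  -- this only on average. By Markov's inequality at most 1/4 of the mass has `miss` above δ; with
  -- the 1/4 lost outside A, S keeps half.
  set S := A.filter fun e => miss e ≤ δ with hS
  have hSprob : ∑ e, wordLaw α e * (if e ∈ S then 0 else 1) ≤ 1 / 2 := by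
    have h1 : ∀ e, wordLaw α e * (if e ∈ S then (0 : ℝ) else 1)
        ≤ wordLaw α e * (if e ∈ A then 0 else 1) + δ⁻¹ * (wordLaw α e * miss e) := by
      intro e
      rw [mul_left_comm, ← mul_add]
      refine mul_le_mul_of_nonneg_left ?_ (hPα.nonneg e)
      have h2 : 0 ≤ δ⁻¹ * miss e := mul_nonneg (by positivity) (hmiss0 e)
      by_cases h3 : e ∈ A
      · by_cases h4 : miss e ≤ δ
        · simp [hS, h3, h4]
          simpa using h2
        · have h5 : 1 ≤ δ⁻¹ * miss e := by
            rw [← div_eq_inv_mul, one_le_div hδ0]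
            exact (not_le.1 h4).le
          simp [hS, h3, h4]
          simpa using h5
      · simp [hS, h3]
        simpa using h2
    refine (Finset.sum_le_sum fun e _ => h1 e).trans ?_
    rw [Finset.sum_add_distrib, ← Finset.mul_sum]
    have h2 : δ⁻¹ * ∑ e, wordLaw α e * miss e ≤ δ⁻¹ * (δ / 4) := by gcongr
    have h3 : δ⁻¹ * (δ / 4) = 1 / 4 := by field_simp
    linarith
  have hScard : (1 - 1 / 2) * (2 : ℝ) ^ (k * (H2 α - δ)) ≤ S.card :=
    le_card_of_prob_le hPα hSprob fun e he => (hAt e (Finset.mem_filter.1 he).1).2.1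
  have hTcard : (T.card : ℝ) ≤ 2 ^ (k * (H2 γ + δ)) :=
    card_le_of_prob_ge (isProb_wordLaw hγ k) fun e he => (hTt e he).1
  have hSpos : (0 : ℝ) < S.card := lt_of_lt_of_le (by positivity) hScard
  have hSne : S.Nonempty := Finset.card_pos.1 (by exact_mod_cast hSpos)
  -- The bin size is limited by false matches: a uniform word passes the test with probability about
  -- 2^(−k(1 − H₂(γ))).
  set K := expSize (k * (1 - H2 γ - 2 * δ)) with hK
  have : Nonempty (Fin M) := ⟨⟨0, hM⟩⟩
  have : Nonempty (Fin K) := ⟨⟨0, expSize_pos _⟩⟩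
  obtain ⟨enc, dec, h⟩ := exists_binning_code (I := Fin M) (J := Fin K) hPβ hSne
    (fun e he => (Finset.mem_filter.1 he).2 : ∀ e ∈ S, miss e ≤ δ)
  refine ⟨enc, dec, ?_⟩
  rw [Fintype.card_fin, Fintype.card_fin] at h
  have hM' : (2 : ℝ) ^ (k * (r α β + ε)) ≤ M := by
    rwa [Real.le_logb_iff_rpow_le one_lt_two (by exact_mod_cast hM)] at hMr
  have b1 : 4 * (Fintype.card (Fin k → Bool) : ℝ) / (M * K * S.card) ≤ 8 * 2 ^ (-(k * δ)) := by
    have e1 : (1 / 2 : ℝ) * 2 ^ ((k : ℝ) + k * δ) ≤ M * K * S.card := by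
      calc (1 / 2 : ℝ) * 2 ^ ((k : ℝ) + k * δ)
          ≤ (1 / 2 : ℝ) * 2 ^ (k * (r α β + ε) + k * (1 - H2 γ - 2 * δ) + k * (H2 α - δ)) := by
            refine mul_le_mul_of_nonneg_left
              (Real.rpow_le_rpow_of_exponent_le one_le_two ?_) (by norm_num)
            have : (0 : ℝ) ≤ k * δ := by positivity
            simp only [r, ← hγd]
            rw [show ε = 8 * δ by rw [hδ]; ring]
            linarith
        _ = 2 ^ (k * (r α β + ε)) * 2 ^ (k * (1 - H2 γ - 2 * δ))
              * ((1 - 1 / 2) * 2 ^ (k * (H2 α - δ))) := by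
            rw [Real.rpow_add two_pos, Real.rpow_add two_pos]; ring
        _ ≤ M * K * S.card := by
            gcongr
            exact rpow_le_expSize _
    rw [card_words, div_le_iff₀ (lt_of_lt_of_le (by positivity) e1)]
    calc 4 * (2 : ℝ) ^ (k : ℝ) = 8 * 2 ^ (-(k * δ)) * ((1 / 2 : ℝ) * 2 ^ ((k : ℝ) + k * δ)) := by
          have : (2 : ℝ) ^ (-(k * δ)) * 2 ^ ((k : ℝ) + k * δ) = 2 ^ (k : ℝ) := by
            rw [← Real.rpow_add two_pos]; congr 1; ring
          rw [← this]; ring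
      _ ≤ _ := by gcongr
  have b2 : ((K : ℝ) - 1) * T.card / (Fintype.card (Fin k → Bool) : ℝ) ≤ 2 ^ (-(k * δ)) := by
    rw [card_words, div_le_iff₀ (by positivity)]
    calc ((K : ℝ) - 1) * T.card
        ≤ 2 ^ (k * (1 - H2 γ - 2 * δ)) * 2 ^ (k * (H2 γ + δ)) := by
          gcongr
          exact expSize_sub_one_le _
      _ = _ := by
          rw [← Real.rpow_add two_pos, ← Real.rpow_add two_pos]; congr 1; ring
  have herr : ∑ x, (1 / Fintype.card (Fin k → Bool) : ℝ) *
      ∑ N, wordLaw β N * (if x - dec (enc x) (x + N) ∈ S then 0 else 1) ≤ 3 * δ := by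
    linarith
  have hU : IsProb fun _ : Fin k → Bool => (1 / Fintype.card (Fin k → Bool) : ℝ) := isProb_uniform
  have hUe : (1 / Fintype.card (Fin k → Bool) : ℝ) = (1 / 2) ^ k := by
    simp
  have hpt : ∀ x N, (hammingDist x (dec (enc x) (x + N)) : ℝ)
      ≤ k * (α + δ) + k * (if x - dec (enc x) (x + N) ∈ S then 0 else 1) := by
    intro x N
    rw [← weight_sub]
    split_ifs with hs
    · have := (hAt _ (Finset.mem_filter.1 hs).1).2.2
      linarith
    · have h1 := weight_le (x - dec (enc x) (x + N))
      have h2 : 0 ≤ k * (α + δ) := mul_nonneg (Nat.cast_nonneg k) (add_nonneg hα.1 hδ0.le)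
      linarith
  rw [← hUe]
  calc _ ≤ ∑ x : Fin k → Bool, (1 / Fintype.card (Fin k → Bool) : ℝ) *
          ∑ N, wordLaw β N * (k * (α + δ)
            + k * (if x - dec (enc x) (x + N) ∈ S then 0 else 1)) := by
        refine Finset.sum_le_sum fun x _ => mul_le_mul_of_nonneg_left
          (Finset.sum_le_sum fun N _ => mul_le_mul_of_nonneg_left (hpt x N) (hPβ.nonneg N))
          (hU.nonneg x)
    _ = k * (α + δ) + k * ∑ x, (1 / Fintype.card (Fin k → Bool) : ℝ) *
      ∑ N, wordLaw β N * (if x - dec (enc x) (x + N) ∈ S then 0 else 1) := by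
        simp only [hPβ.sum_mul_affine, hU.sum_mul_affine]
    _ ≤ k * (α + δ) + k * (3 * δ) := by gcongr
    _ ≤ k * (α + ε) := by
        have : (0 : ℝ) ≤ k * δ := by positivity
        rw [show ε = 8 * δ by rw [hδ]; ring]
        linarith

/-! ### Superposition coding for the binary broadcast channel -/

theorem sum_mul_sum_comm {A B : Type*} [Fintype A] [Fintype B] (f : A → ℝ) (g : B → ℝ)
    (h : A → B → ℝ) : ∑ a, f a * ∑ b, g b * h a b = ∑ b, g b * ∑ a, f a * h a b := by
  simp only [Finset.mul_sum]
  rw [Finset.sum_comm]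
  exact Finset.sum_congr rfl fun b _ => Finset.sum_congr rfl fun a _ => by ring

/-- Superposition coding achieves the capacity region of the degraded binary symmetric broadcast
channel. -/
theorem exists_channel_code {θ pb pg : ℝ} (hθ : θ ∈ Set.Icc (0 : ℝ) 1)
    (hpb : pb ∈ Set.Icc (0 : ℝ) 1) (hpg : pg ∈ Set.Icc (0 : ℝ) 1)
    (hle : H2 (binConv θ pg) ≤ H2 (binConv θ pb)) {ε : ℝ} (hε : 0 < ε) :
    ∃ m₀ : ℕ, ∀ m : ℕ, m₀ ≤ m → ∃ (Mb Mp : ℕ) (c : ChannelCode m Mb Mp), 0 < Mb ∧ 0 < Mp ∧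
      m * (1 - H2 (binConv θ pb) - ε) ≤ Real.logb 2 Mb ∧
      m * (H2 (binConv θ pg) - H2 pg - ε) ≤ Real.logb 2 Mp ∧
      c.errB pb + c.errG pg ≤ ε := by
  classical
  set δ := ε / 8 with hδ
  have hε8 : ε = 8 * δ := by rw [hδ]; ring
  have hδ0 : 0 < δ := by positivity
  have hsb := binConv_mem hθ hpb
  have hsg := binConv_mem hθ hpg
  set sb := binConv θ pb with hsbd
  set sg := binConv θ pg with hsgd
  obtain ⟨m₁, hm₁⟩ := exists_typical hsb hδ0 hδ0
  obtain ⟨m₂, hm₂⟩ := exists_typical hsg hδ0 hδ0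
  obtain ⟨m₃, hm₃⟩ := exists_typical hpg hδ0 hδ0
  obtain ⟨m₄, hm₄⟩ := exists_rpow_neg_le hδ0 hδ0
  refine ⟨max (max m₁ m₂) (max m₃ m₄), fun m hm => ?_⟩
  simp only [max_le_iff] at hm
  obtain ⟨⟨hm1, hm2⟩, hm3, hm4⟩ := hm
  obtain ⟨Tb, hTb, hTbt⟩ := hm₁ m hm1
  obtain ⟨Tg, hTg, hTgt⟩ := hm₂ m hm2
  obtain ⟨Tn, hTn, hTnt⟩ := hm₃ m hm3
  have hsmall := hm₄ m hm4
  have hPθ := isProb_wordLaw hθ m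
  have hPb := isProb_wordLaw hpb m
  have hPg := isProb_wordLaw hpg m
  have cb : (Tb.card : ℝ) ≤ 2 ^ (m * (H2 sb + δ)) :=
    card_le_of_prob_ge (isProb_wordLaw hsb m) fun e he => (hTbt e he).1
  -- By `hle` the decoding set of `g` obeys the size bound for `b`, so a cloud rate suited to `b`
  -- also suits `g`.
  have cg : (Tg.card : ℝ) ≤ 2 ^ (m * (H2 sb + δ)) :=
    (card_le_of_prob_ge (isProb_wordLaw hsg m) fun e he => (hTgt e he).1).trans (by
      gcongr
      norm_num)
  have cn : (Tn.card : ℝ) ≤ 2 ^ (m * (H2 pg + δ)) :=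
    card_le_of_prob_ge hPg fun e he => (hTnt e he).1
  set η : ℝ := 2 ^ (-(m * (H2 sg - δ))) * 2 ^ (m * (H2 pg + δ)) with hη
  have hηle : ∑ z, wordLaw θ z * ∑ z', wordLaw θ z' * ∑ N, wordLaw pg N *
      (if z + N ∈ Tg ∧ z + N - z' ∈ Tn then (1 : ℝ) else 0) ≤ η := by
    -- With the competitor z' held fixed, the true satellite plus noise has law Ber(θ⋆p_g). Each
    -- word of `Tg` has small mass under it, and at most |`Tn`| of them match z'.
    have e1 : ∑ z, wordLaw θ z * ∑ z', wordLaw θ z' * ∑ N, wordLaw pg N *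
        (if z + N ∈ Tg ∧ z + N - z' ∈ Tn then (1 : ℝ) else 0)
        = ∑ z' : Fin m → Bool, wordLaw θ z' * ∑ z, wordLaw θ z * ∑ N, wordLaw pg N *
          (if z + N ∈ Tg ∧ z + N - z' ∈ Tn then (1 : ℝ) else 0) := by
      exact sum_mul_sum_comm _ _ _
    rw [e1]
    refine sum_mul_le_of_le hPθ fun z' => ?_
    rw [sum_wordLaw_conv θ pg fun e => if e ∈ Tg ∧ e - z' ∈ Tn then (1 : ℝ) else 0, ← hsgd]
    calc ∑ e, wordLaw sg e * (if e ∈ Tg ∧ e - z' ∈ Tn then (1 : ℝ) else 0)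
        ≤ ∑ e : Fin m → Bool, 2 ^ (-(m * (H2 sg - δ))) * (if e - z' ∈ Tn then (1 : ℝ) else 0) := by
          refine Finset.sum_le_sum fun e _ => ?_
          by_cases h1 : e ∈ Tg
          · by_cases h2 : e - z' ∈ Tn
            · simpa [h1, h2] using (hTgt e h1).2.1
            · simp [h2]
          · simp only [h1, false_and, if_false, mul_zero]
            split_ifs <;> positivity
      _ = 2 ^ (-(m * (H2 sg - δ))) * Tn.card := by
          rw [← Finset.mul_sum]
          have h3 := Equiv.sum_comp (Equiv.subRight z') fun g => if g ∈ Tn then (1 : ℝ) else 0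
          simp only [Equiv.subRight_apply] at h3
          rw [h3]
          simp
      _ ≤ η := by rw [hη]; gcongr
  set Mb := expSize (m * (1 - H2 sb - ε)) with hMb
  set Mp := expSize (m * (H2 sg - H2 pg - ε)) with hMp
  have hMb0 : 0 < Mb := expSize_pos _
  have hMp0 : 0 < Mp := expSize_pos _
  have : Nonempty (Fin Mb) := ⟨⟨0, hMb0⟩⟩
  have : Nonempty (Fin Mp) := ⟨⟨0, hMp0⟩⟩
  obtain ⟨enc, decB, decG, h⟩ := exists_superposition_code (I := Fin Mb) (J := Fin Mp)
    hPθ hPb hPg Tb Tg Tn (ε := δ) (η := η)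
    (by rw [sum_wordLaw_conv θ pb fun e => if e ∈ Tb then (0 : ℝ) else 1]; exact hTb)
    (by rw [sum_wordLaw_conv θ pg fun e => if e ∈ Tg then (0 : ℝ) else 1]; exact hTg)
    hTn hηle
  refine ⟨Mb, Mp, ⟨enc, decB, decG⟩, hMb0, hMp0, le_logb_expSize _, le_logb_expSize _, ?_⟩
  rw [Fintype.card_fin, Fintype.card_fin] at h
  have hpos : (0 : ℝ) < Mb * Mp := by positivity
  simp only [ChannelCode.errB, ChannelCode.errG, sum_bscWord_mul]
  rw [← add_div, ← Finset.sum_add_distrib, div_le_iff₀ hpos, mul_comm ε]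
  refine h.trans (mul_le_mul_of_nonneg_left ?_ hpos.le)
  have hmδ : (0 : ℝ) ≤ m * δ := by positivity
  have b1 : ((Mb : ℝ) - 1) * (Tb.card + Tg.card) / (Fintype.card (Fin m → Bool) : ℝ)
      ≤ 2 * 2 ^ (-(m * δ)) := by
    rw [card_words, div_le_iff₀ (by positivity)]
    calc ((Mb : ℝ) - 1) * (Tb.card + Tg.card)
        ≤ 2 ^ (m * (1 - H2 sb - ε)) * (2 ^ (m * (H2 sb + δ)) + 2 ^ (m * (H2 sb + δ))) := by
          exact mul_le_mul (expSize_sub_one_le _) (add_le_add cb cg)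
            (add_nonneg (Nat.cast_nonneg _) (Nat.cast_nonneg _)) (by positivity)
      _ = 2 * 2 ^ (m * (1 - H2 sb - ε) + m * (H2 sb + δ)) := by
          rw [Real.rpow_add two_pos]; ring
      _ ≤ 2 * 2 ^ (-(m * δ) + (m : ℝ)) := by
          refine mul_le_mul_of_nonneg_left
            (Real.rpow_le_rpow_of_exponent_le one_le_two ?_) two_pos.le
          rw [hε8]; linarith
      _ = _ := by rw [Real.rpow_add two_pos]; ring
  have b2 : ((Mp : ℝ) - 1) * η ≤ 2 ^ (-(m * δ)) := by
    calc ((Mp : ℝ) - 1) * η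
        ≤ 2 ^ (m * (H2 sg - H2 pg - ε)) * η := by
          gcongr
          exact expSize_sub_one_le _
      _ = 2 ^ (m * (H2 sg - H2 pg - ε) + (-(m * (H2 sg - δ)) + m * (H2 pg + δ))) := by
          rw [hη, Real.rpow_add two_pos, Real.rpow_add two_pos]
      _ ≤ _ := by
          refine Real.rpow_le_rpow_of_exponent_le one_le_two ?_
          rw [hε8]; linarith
  linarith

/-! ### Source means -/

theorem sourceMean_eq (β : ℝ) {n : ℕ} (f : (Fin n → Bool) → (Fin n → Bool) → ℝ) :
    sourceMean β f = ∑ x : Fin n → Bool, (1 / 2 : ℝ) ^ n * ∑ N, wordLaw β N * f x (x + N) :=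
  Finset.sum_congr rfl fun x _ => by rw [sum_bscWord_mul β x fun y => f x y]

theorem isProb_half (n : ℕ) : IsProb fun _ : Fin n → Bool => (1 / 2 : ℝ) ^ n := by
  have h : (1 / Fintype.card (Fin n → Bool) : ℝ) = (1 / 2) ^ n := by simp
  rw [← h]
  exact isProb_uniform

theorem isProb_bscWord {p : ℝ} (hp : p ∈ Set.Icc (0 : ℝ) 1) {k : ℕ} (u : Fin k → Bool) :
    IsProb (bscWord p u) where
  nonneg v := by
    rw [bscWord_eq]
    exact (isProb_wordLaw hp k).nonneg _
  sum_eq_one := by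
    have h := sum_bscWord_mul p u fun _ => 1
    simp only [mul_one] at h
    rw [h, (isProb_wordLaw hp k).sum_eq_one]

theorem sourceMean_mono {β : ℝ} (hβ : β ∈ Set.Icc (0 : ℝ) 1) {n : ℕ}
    {f g : (Fin n → Bool) → (Fin n → Bool) → ℝ} (h : ∀ x y, f x y ≤ g x y) :
    sourceMean β f ≤ sourceMean β g :=
  Finset.sum_le_sum fun x _ => mul_le_mul_of_nonneg_left
    (Finset.sum_le_sum fun y _ => mul_le_mul_of_nonneg_left (h x y) ((isProb_bscWord hβ x).nonneg y))
    (by positivity)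

theorem sourceMean_div (β : ℝ) {n : ℕ} (f : (Fin n → Bool) → (Fin n → Bool) → ℝ) (a : ℝ) :
    sourceMean β (fun x y => f x y / a) = sourceMean β f / a := by
  simp only [sourceMean, Finset.sum_div, Finset.mul_sum]
  exact Finset.sum_congr rfl fun x _ => Finset.sum_congr rfl fun y _ => by ring

theorem sourceMean_add_of_fst {β : ℝ} (hβ : β ∈ Set.Icc (0 : ℝ) 1) {n : ℕ}
    (f : (Fin n → Bool) → (Fin n → Bool) → ℝ) (g : (Fin n → Bool) → ℝ) :
    sourceMean β (fun x y => f x y + g x)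
      = sourceMean β f + ∑ x : Fin n → Bool, (1 / 2 : ℝ) ^ n * g x := by
  rw [sourceMean, sourceMean, ← Finset.sum_add_distrib]
  refine Finset.sum_congr rfl fun x _ => ?_
  rw [← mul_add]
  congr 1
  simp only [mul_add, Finset.sum_add_distrib, ← Finset.sum_mul, (isProb_bscWord hβ x).sum_eq_one,
    one_mul]

theorem sum_words_append {k l : ℕ} (f : (Fin (k + l) → Bool) → ℝ) :
    ∑ x, f x = ∑ a : Fin k → Bool, ∑ b : Fin l → Bool, f (Fin.append a b) := by
  rw [← Fintype.sum_prod_type']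
  exact (Equiv.sum_comp (Fin.appendEquiv k l) f).symm

theorem bscWord_append (p : ℝ) {k l : ℕ} (a c : Fin k → Bool) (b d : Fin l → Bool) :
    bscWord p (Fin.append a b) (Fin.append c d) = bscWord p a c * bscWord p b d := by
  simp [bscWord, Fin.prod_univ_add]

/-- The source mean of a sum of contributions of two consecutive blocks. -/
theorem sourceMean_append {β : ℝ} (hβ : β ∈ Set.Icc (0 : ℝ) 1) {k l : ℕ}
    {f : (Fin (k + l) → Bool) → (Fin (k + l) → Bool) → ℝ}
    {g : (Fin k → Bool) → (Fin k → Bool) → ℝ} {h : (Fin l → Bool) → (Fin l → Bool) → ℝ}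
    (hf : ∀ a b c d, f (Fin.append a b) (Fin.append c d) = g a c + h b d) :
    sourceMean β f = sourceMean β g + sourceMean β h := by
  simp only [sourceMean, sum_words_append, hf, bscWord_append]
  have e1 : ∀ (a : Fin k → Bool) (b : Fin l → Bool),
      ∑ c, ∑ d, bscWord β a c * bscWord β b d * (g a c + h b d)
        = ∑ c, bscWord β a c * g a c + 1 * ∑ d, bscWord β b d * h b d := by
    intro a b
    have e2 : ∀ c, ∑ d, bscWord β a c * bscWord β b d * (g a c + h b d)
        = bscWord β a c * (∑ d, bscWord β b d * h b d + 1 * g a c) := by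
      intro c
      have := (isProb_bscWord hβ b).sum_mul_affine (g a c) 1 (h b)
      simp only [one_mul] at this
      simp only [mul_assoc, ← Finset.mul_sum, this, one_mul]
      ring
    simp only [e2, (isProb_bscWord hβ a).sum_mul_affine]
    ring
  have e3 : ∀ a : Fin k → Bool, ∑ b : Fin l → Bool, (1 / 2 : ℝ) ^ (k + l) *
      (∑ c, bscWord β a c * g a c + 1 * ∑ d, bscWord β b d * h b d)
      = (1 / 2 : ℝ) ^ k * (∑ b : Fin l → Bool, (1 / 2 : ℝ) ^ l * ∑ d, bscWord β b d * h b d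
        + 1 * ∑ c, bscWord β a c * g a c) := by
    intro a
    have := (isProb_half l).sum_mul_affine (∑ c, bscWord β a c * g a c) 1
      fun b => ∑ d, bscWord β b d * h b d
    simp only [pow_add, mul_assoc, ← Finset.mul_sum (a := (1 / 2 : ℝ) ^ k), this]
    ring
  simp only [e1, e3]
  rw [(isProb_half k).sum_mul_affine]
  ring

theorem hammingDist_append {k l : ℕ} (a c : Fin k → Bool) (b d : Fin l → Bool) :
    (hammingDist (Fin.append a b) (Fin.append c d) : ℝ) = hammingDist a c + hammingDist b d := by
  simp [hammingDist, Finset.card_filter, Fin.sum_univ_add]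

theorem sum_wordLaw_mul_weight {β : ℝ} (hβ : β ∈ Set.Icc (0 : ℝ) 1) (k : ℕ) :
    ∑ N : Fin k → Bool, wordLaw β N * weight N = k * β := by
  have h1 : ∀ i : Fin k, iidMean (bern β) (fun N : Fin k → Bool => if N i then (1 : ℝ) else 0) = β :=
    fun i => by
      rw [iidMean_apply (isProb_bern hβ) i fun b => if b then (1 : ℝ) else 0]
      simp [bern]
  have h2 : iidMean (bern β) (fun N : Fin k → Bool => ∑ i, if N i then (1 : ℝ) else 0) = k * β := by
    rw [iidMean_sum]
    simp [h1]
  exact h2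

theorem sourceMean_hammingDist {β : ℝ} (hβ : β ∈ Set.Icc (0 : ℝ) 1) (k : ℕ) :
    sourceMean β (fun x y : Fin k → Bool => (hammingDist x y : ℝ)) = k * β := by
  have h : ∀ x N : Fin k → Bool, (hammingDist x (x + N) : ℝ) = weight N := fun x N => by
    rw [← weight_sub, sub_add_cancel_left]
    rfl
  simp only [sourceMean_eq, h, sum_wordLaw_mul_weight hβ, ← Finset.sum_mul,
    (isProb_half k).sum_eq_one, one_mul]

theorem hammingDist_not {k : ℕ} (x y : Fin k → Bool) :
    (hammingDist x (fun i => !y i) : ℝ) = k - hammingDist x y := by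
  rw [eq_sub_iff_add_eq, ← Nat.cast_add, Nat.cast_inj]
  simp only [hammingDist, Finset.card_filter]
  rw [← Finset.sum_add_distrib]
  have : ∀ i, ((if x i ≠ !y i then 1 else 0) + if x i ≠ y i then 1 else 0) = 1 := fun i => by
    cases x i <;> cases y i <;> rfl
  rw [Finset.sum_congr rfl fun i _ => this i]
  simp

/-- Complementing the side information covers the zero-rate case with α < β, where copying y may be
too poor. -/
theorem sourceMean_hammingDist_not {β : ℝ} (hβ : β ∈ Set.Icc (0 : ℝ) 1) (k : ℕ) :
    sourceMean β (fun x y : Fin k → Bool => (hammingDist x (fun i => !y i) : ℝ)) = k * (1 - β) := by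
  have h := sourceMean_hammingDist hβ k
  simp only [sourceMean] at h ⊢
  have e : ∀ x : Fin k → Bool, ∑ y, bscWord β x y * (hammingDist x (fun i => !y i) : ℝ)
      = k + (-1) * ∑ y, bscWord β x y * (hammingDist x y : ℝ) := fun x => by
    rw [← (isProb_bscWord hβ x).sum_mul_affine]
    simp only [hammingDist_not]
    exact Finset.sum_congr rfl fun y _ => by ring
  simp only [e, (isProb_half k).sum_mul_affine, h]
  ring

/-! ### Wyner-Ziv coding with time sharing -/

/-- Wyner-Ziv coding of a fraction `q` of the symbols. When the rate is positive, a rate slightly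
smaller than `q * r α β` suffices. -/
theorem exists_wynerZiv_code {α β q : ℝ} (hα : α ∈ Set.Icc (0 : ℝ) (1 / 2))
    (hβ : β ∈ Set.Icc (0 : ℝ) 1) (hq : q ∈ Set.Icc (0 : ℝ) 1) {ε : ℝ} (hε : 0 < ε) :
    ∃ δ : ℝ, 0 < δ ∧ ∃ n₀ : ℕ, ∀ n : ℕ, n₀ < n → ∀ M : ℕ, 0 < M →
      n * (q * r α β - δ) ≤ Real.logb 2 M →
      ∃ (enc : (Fin n → Bool) → Fin M) (dec : Fin M → (Fin n → Bool) → (Fin n → Bool)),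
        sourceMean β (fun x y => distortion x (dec (enc x) y))
          ≤ q * min α β + (1 - q) * β + ε := by
  -- When a function of y alone meets the target, the index is irrelevant and any M ≥ 1 works, so
  -- the rate slack is free.
  have htriv : ∀ D : ℝ, (∀ n : ℕ, ∃ g : (Fin n → Bool) → (Fin n → Bool),
      sourceMean β (fun x y => (hammingDist x (g y) : ℝ)) ≤ n * D) →
      D ≤ q * min α β + (1 - q) * β → ∃ δ : ℝ, 0 < δ ∧ ∃ n₀ : ℕ, ∀ n : ℕ, n₀ < n → ∀ M : ℕ, 0 < M →
      n * (q * r α β - δ) ≤ Real.logb 2 M →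
      ∃ (enc : (Fin n → Bool) → Fin M) (dec : Fin M → (Fin n → Bool) → (Fin n → Bool)),
        sourceMean β (fun x y => distortion x (dec (enc x) y))
          ≤ q * min α β + (1 - q) * β + ε := by
    intro D hD hDle
    refine ⟨1, one_pos, 0, fun n hn M hM _ => ?_⟩
    obtain ⟨g, hg⟩ := hD n
    refine ⟨fun _ => ⟨0, hM⟩, fun _ y => g y, ?_⟩
    have hn' : (0 : ℝ) < n := by exact_mod_cast hn
    simp only [distortion]
    rw [sourceMean_div, div_le_iff₀ hn']
    refine hg.trans ?_
    rw [mul_comm]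
    gcongr
    linarith
  have hα1 : α ∈ Set.Icc (0 : ℝ) 1 := ⟨hα.1, by linarith [hα.2]⟩
  by_cases hcase : q = 0 ∨ β ≤ α
  · refine htriv β (fun n => ⟨id, (sourceMean_hammingDist hβ n).le⟩) ?_
    rcases hcase with h | h
    · simp [h]
    · rw [min_eq_right h]; linarith
  push Not at hcase
  obtain ⟨hq0, hαβ⟩ := hcase
  have hqpos : 0 < q := lt_of_le_of_ne hq.1 (Ne.symm hq0)
  rw [min_eq_left hαβ.le] at htriv ⊢
  rcases (r_nonneg hα1 hβ).eq_or_lt with hr | hr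
  · refine htriv (1 - β) (fun n => ⟨fun y i => !y i, (sourceMean_hammingDist_not hβ n).le⟩) ?_
    have h : α = 1 / 2 ∨ β = 1 := by
      by_contra! hne
      have := r_pos (a := α) (b := β) ⟨hα.1, lt_of_le_of_ne hα.2 hne.1⟩
        ⟨lt_of_le_of_lt hα.1 hαβ, lt_of_le_of_ne hβ.2 hne.2⟩
      linarith
    rcases h with h | h
    · subst h
      nlinarith [hq.1, hq.2]
    · subst h
      nlinarith [mul_nonneg hq.1 hα.1, hq.2]
  -- Coding η fewer symbols per source symbol costs at most η in distortion and saves rate η·r(α,β).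
  -- Half of the saving becomes the slack δ, and half pays for the excess rate ε₁ of the block code.
  set η := min (q / 2) (ε / 4) with hη
  have hη0 : 0 < η := by positivity
  have hηq : η ≤ q / 2 := min_le_left _ _
  have hηε : η ≤ ε / 4 := min_le_right _ _
  set ε₁ := min (η * r α β / 2) (ε / 4) with hε₁
  have hε₁0 : 0 < ε₁ := by positivity
  have hε₁r : ε₁ ≤ η * r α β / 2 := min_le_left _ _
  have hε₁ε : ε₁ ≤ ε / 4 := min_le_right _ _
  obtain ⟨k₀, hk₀⟩ := exists_block_code hα1 hβ hε₁0
  set q' := q - η with hq'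
  have hq'0 : 0 < q' := by rw [hq']; linarith
  have hq'1 : q' ≤ 1 := by rw [hq']; linarith [hq.2]
  refine ⟨η * r α β / 2, by positivity, max ⌈(k₀ : ℝ) / q'⌉₊ ⌈4 / ε⌉₊, fun n hn M hM hrate => ?_⟩
  rw [max_lt_iff] at hn
  have hn1 : (k₀ : ℝ) ≤ q' * n := by
    have : (k₀ : ℝ) / q' ≤ n := (Nat.le_ceil _).trans (by exact_mod_cast hn.1.le)
    rw [div_le_iff₀ hq'0] at this
    linarith
  have hn2 : 1 ≤ n * (ε / 4) := by
    have : 4 / ε ≤ n := (Nat.le_ceil _).trans (by exact_mod_cast hn.2.le)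
    rw [div_le_iff₀ hε] at this
    linarith
  have hn0 : (0 : ℝ) < n := by exact_mod_cast (Nat.zero_le _).trans_lt hn.1
  set k := ⌊q' * n⌋₊ with hk
  have hk1 : (k : ℝ) ≤ q' * n := Nat.floor_le (by positivity)
  have hk2 : q' * n < k + 1 := Nat.lt_floor_add_one _
  have hkk₀ : k₀ ≤ k := Nat.le_floor hn1
  have hkn : k ≤ n := by
    have : (k : ℝ) ≤ n := hk1.trans (mul_le_of_le_one_left hn0.le hq'1)
    exact_mod_cast this
  have hkrate : k * (r α β + ε₁) ≤ Real.logb 2 M := by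
    refine le_trans ?_ hrate
    calc (k : ℝ) * (r α β + ε₁) ≤ q' * n * (r α β + ε₁) := by gcongr
      _ = n * (q' * r α β + q' * ε₁) := by ring
      _ ≤ n * (q * r α β - η * r α β / 2) := by
        refine mul_le_mul_of_nonneg_left ?_ hn0.le
        have : q' * ε₁ ≤ ε₁ := mul_le_of_le_one_left hε₁0.le hq'1
        have e : q' * r α β = q * r α β - η * r α β := by rw [hq']; ring
        linarith
  obtain ⟨enc, dec, h⟩ := hk₀ k hkk₀ M hM hkrate
  clear_value k
  obtain ⟨l, rfl⟩ := Nat.exists_eq_add_of_le hkn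
  rw [← sourceMean_eq β fun x y => (hammingDist x (dec (enc x) y) : ℝ)] at h
  refine ⟨fun x => enc fun i => x (Fin.castAdd l i),
    fun j y => Fin.append (dec j fun i => y (Fin.castAdd l i)) fun i => y (Fin.natAdd k i), ?_⟩
  simp only [distortion]
  rw [sourceMean_div, div_le_iff₀ hn0,
    sourceMean_append hβ (g := fun x y => (hammingDist x (dec (enc x) y) : ℝ))
      (h := fun x y => (hammingDist x y : ℝ)) (fun a b c d => by
        simp [hammingDist_append]), sourceMean_hammingDist hβ]
  refine (add_le_add_left h _).trans ?_
  push_cast at *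
  have hβα : β - α ≤ 1 := by linarith [hβ.2, hα.1]
  -- The −1 is the rounding in k = ⌊q'n⌋; this one symbol is absorbed by `hn2`.
  have e1 : (q' * (k + l) - 1) * (β - α) ≤ k * (β - α) :=
    mul_le_mul_of_nonneg_right (by linarith) (by linarith)
  have e2 : η * (k + l) * (β - α) ≤ η * (k + l) :=
    mul_le_of_le_one_right (by positivity) hβα
  have e3 : η * (k + l : ℝ) ≤ ε / 4 * (k + l) := by gcongr
  have e4 : (k : ℝ) * ε₁ ≤ (k + l) * (ε / 4) := by
    gcongr
    linarith [(Nat.cast_nonneg l : (0 : ℝ) ≤ l)]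
  have e5 : 0 ≤ ε * (k + l : ℝ) := by positivity
  rw [hq'] at e1
  nlinarith

/-! ### Separate source and channel coding -/

theorem distortion_nonneg {n : ℕ} (x z : Fin n → Bool) : 0 ≤ distortion x z := by
  rw [distortion]; positivity

theorem distortion_le_one {n : ℕ} (x z : Fin n → Bool) : distortion x z ≤ 1 := by
  refine div_le_one_of_le₀ ?_ (Nat.cast_nonneg n)
  have := hammingDist_le_card_fintype (x := x) (y := z)
  rw [Fintype.card_fin] at this
  exact_mod_cast this

theorem logb_expSize_le {x : ℝ} (hx : 0 ≤ x) : Real.logb 2 (expSize x) ≤ x + 1 := by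
  rw [Real.logb_le_iff_le_rpow one_lt_two (by exact_mod_cast expSize_pos x),
    Real.rpow_add two_pos, Real.rpow_one]
  have h1 := expSize_sub_one_le x
  have h2 := Real.one_le_rpow one_le_two hx
  linarith

/-- Two independent Wyner-Ziv codes give a two-layer source code. -/
theorem mem_sourceRegion {αb βb qb αg βg qg Db Dg : ℝ}
    (hβb : βb ∈ Set.Icc (0 : ℝ) 1) (hβg : βg ∈ Set.Icc (0 : ℝ) 1)
    (hqb : qb ∈ Set.Icc (0 : ℝ) 1) (hqg : qg ∈ Set.Icc (0 : ℝ) 1)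
    (hαb : αb ∈ Set.Icc (0 : ℝ) (1 / 2)) (hαg : αg ∈ Set.Icc (0 : ℝ) (1 / 2))
    (hDb : qb * min αb βb + (1 - qb) * βb ≤ Db) (hDg : qg * min αg βg + (1 - qg) * βg ≤ Dg) :
    (qb * r αb βb, qb * r αb βb + qg * r αg βg) ∈ sourceRegion βb βg Db Dg := by
  intro ε hε
  obtain ⟨δb, hδb, nb, hb⟩ := exists_wynerZiv_code hαb hβb hqb hε
  obtain ⟨δg, hδg, ng, hg⟩ := exists_wynerZiv_code hαg hβg hqg hε
  have hRb : 0 ≤ qb * r αb βb := mul_nonneg hqb.1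
    (r_nonneg ⟨hαb.1, by linarith [hαb.2]⟩ hβb)
  have hRg : 0 ≤ qg * r αg βg := mul_nonneg hqg.1
    (r_nonneg ⟨hαg.1, by linarith [hαg.2]⟩ hβg)
  refine ⟨max (max nb ng) ⌈2 / ε⌉₊, fun n hn => ?_⟩
  rw [max_lt_iff, max_lt_iff] at hn
  have hn2 : 2 ≤ n * ε := by
    have : 2 / ε ≤ n := (Nat.le_ceil _).trans (by exact_mod_cast hn.2.le)
    rwa [div_le_iff₀ hε] at this
  have hn0 : (0 : ℝ) ≤ n := Nat.cast_nonneg n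
  have hrate : ∀ R δ : ℝ, 0 < δ → n * (R - δ) ≤ Real.logb 2 (expSize (n * R)) := fun R δ hδ =>
    (mul_le_mul_of_nonneg_left (by linarith) hn0).trans (le_logb_expSize _)
  obtain ⟨encb, decb, hcb⟩ := hb n hn.1.1 _ (expSize_pos (n * (qb * r αb βb))) (hrate _ _ hδb)
  obtain ⟨encg, decg, hcg⟩ := hg n hn.1.2 _ (expSize_pos (n * (qg * r αg βg))) (hrate _ _ hδg)
  have l1 := logb_expSize_le (mul_nonneg hn0 hRb)
  have l2 := logb_expSize_le (mul_nonneg hn0 hRg)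
  refine ⟨_, _, ⟨fun x => (encb x, encg x), decb, fun a y => decg a.2 y⟩, ?_, ?_, ?_, ?_⟩
  · refine l1.trans ?_
    linarith
  · rw [Real.logb_mul (by exact_mod_cast (expSize_pos _).ne') (by exact_mod_cast (expSize_pos _).ne')]
    refine (add_le_add l1 l2).trans ?_
    simp only [mul_add]
    linarith
  · exact hcb.trans (by linarith)
  · exact hcg.trans (by linarith)

/-- Channel codes whose rates are measured per source symbol. -/
theorem exists_channel_code_per_symbol {κ : ℚ} (hκ : 0 < κ) {pb pg θ Rb Rp : ℝ}
    (hpb : pb ∈ Set.Icc (0 : ℝ) 1) (hpg : pg ∈ Set.Icc (0 : ℝ) 1)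
    (hθ : θ ∈ Set.Icc (0 : ℝ) 1) (hchannel : IsDegraded pg pb)
    (hRb : Rb ≤ κ * (1 - H2 (binConv θ pb))) (hRp : Rp ≤ κ * (H2 (binConv θ pg) - H2 pg))
    {ε : ℝ} (hε : 0 < ε) :
    ∃ n₀ : ℕ, ∀ m n : ℕ, n₀ < n → (m : ℚ) / n = κ →
      ∃ (Mb Mp : ℕ) (c : ChannelCode m Mb Mp), 0 < Mb ∧ 0 < Mp ∧
        n * (Rb - ε) ≤ Real.logb 2 Mb ∧ n * (Rp - ε) ≤ Real.logb 2 Mp ∧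
        c.errB pb + c.errG pg ≤ ε := by
  have hκ' : (0 : ℝ) < κ := by exact_mod_cast hκ
  -- A loss of ε' per channel use is κε' per source symbol; the other bound controls the error
  -- probability.
  set ε' := min ε (ε / κ) with hε'
  have hε'0 : 0 < ε' := by positivity
  obtain ⟨m₀, hm₀⟩ := exists_channel_code hθ hpb hpg (hchannel.H2_binConv_le hθ hpg) hε'0
  refine ⟨⌈(m₀ : ℝ) / κ⌉₊, fun m n hn hmn => ?_⟩
  have hn0 : (0 : ℝ) < n := by exact_mod_cast (Nat.zero_le _).trans_lt hn
  have hm : (m : ℝ) = n * κ := by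
    have h1 : (n : ℚ) ≠ 0 := by exact_mod_cast hn0.ne'
    rw [div_eq_iff h1, mul_comm] at hmn
    exact_mod_cast hmn
  have hmm : m₀ ≤ m := by
    have h1 : (m₀ : ℝ) / κ ≤ n := (Nat.le_ceil _).trans (by exact_mod_cast hn.le)
    rw [div_le_iff₀ hκ', ← hm] at h1
    exact_mod_cast h1
  obtain ⟨Mb, Mp, c, h0, h1, h2, h3, h4⟩ := hm₀ m hmm
  have hκε : κ * ε' ≤ ε := by
    have : ε' ≤ ε / κ := min_le_right _ _
    rw [le_div_iff₀ hκ'] at this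
    linarith
  refine ⟨Mb, Mp, c, h0, h1, le_trans ?_ h2, le_trans ?_ h3, h4.trans (min_le_left _ _)⟩
  · rw [hm, mul_assoc]
    refine mul_le_mul_of_nonneg_left ?_ hn0.le
    rw [mul_sub]
    linarith
  · rw [hm, mul_assoc]
    refine mul_le_mul_of_nonneg_left ?_ hn0.le
    rw [mul_sub]
    linarith

theorem ChannelCode.errB_nonneg {m Mb Mp : ℕ} (c : ChannelCode m Mb Mp) {p : ℝ}
    (hp : p ∈ Set.Icc (0 : ℝ) 1) : 0 ≤ c.errB p := by
  refine div_nonneg (Finset.sum_nonneg fun w _ => Finset.sum_nonneg fun v _ =>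
    mul_nonneg ((isProb_bscWord hp _).nonneg v) ?_) (by positivity)
  split_ifs <;> norm_num

theorem ChannelCode.errG_nonneg {m Mb Mp : ℕ} (c : ChannelCode m Mb Mp) {p : ℝ}
    (hp : p ∈ Set.Icc (0 : ℝ) 1) : 0 ≤ c.errG p := by
  refine div_nonneg (Finset.sum_nonneg fun w _ => Finset.sum_nonneg fun v _ =>
    mul_nonneg ((isProb_bscWord hp _).nonneg v) ?_) (by positivity)
  split_ifs <;> norm_num

theorem mem_capacityRegion {κ : ℚ} (hκ : 0 < κ) {pb pg θ Rb Rp : ℝ}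
    (hpb : pb ∈ Set.Icc (0 : ℝ) 1) (hpg : pg ∈ Set.Icc (0 : ℝ) 1)
    (hθ : θ ∈ Set.Icc (0 : ℝ) 1) (hchannel : IsDegraded pg pb)
    (hRb : Rb ≤ κ * (1 - H2 (binConv θ pb))) (hRp : Rp ≤ κ * (H2 (binConv θ pg) - H2 pg)) :
    (Rb, Rb + Rp) ∈ capacityRegion κ pb pg := by
  intro ε hε
  obtain ⟨n₀, h⟩ := exists_channel_code_per_symbol hκ hpb hpg hθ hchannel hRb hRp (half_pos hε)
  refine ⟨n₀, fun m n _ hn hmn => ?_⟩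
  obtain ⟨Mb, Mp, c, h0, h1, h2, h3, h4⟩ := h m n hn hmn
  have hn0 : (0 : ℝ) ≤ n := Nat.cast_nonneg n
  have hnε : 0 ≤ n * ε := by positivity
  have := c.errB_nonneg hpb
  have := c.errG_nonneg hpg
  refine ⟨Mb, Mp, c, h0, h1, ?_, ?_, by linarith, by linarith⟩
  · simp only [mul_sub] at h2 ⊢
    linarith
  · rw [Real.logb_mul (by exact_mod_cast h0.ne') (by exact_mod_cast h1.ne')]
    simp only [mul_sub, mul_add] at h2 h3 ⊢
    linarith

/-- The expected distortion with a decoder that first decodes the message `msg x` from the channel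
output exceeds the distortion with the correct message by at most the decoding error probability. -/
theorem expDistortion_le {p β : ℝ} (hp : p ∈ Set.Icc (0 : ℝ) 1) (hβ : β ∈ Set.Icc (0 : ℝ) 1)
    {m n : ℕ} {A : Type*} [DecidableEq A] (enc : (Fin n → Bool) → (Fin m → Bool))
    (dec : (Fin m → Bool) → (Fin n → Bool) → (Fin n → Bool)) (msg : (Fin n → Bool) → A)
    (rec : A → (Fin n → Bool) → (Fin n → Bool)) (guess : (Fin m → Bool) → A)
    (hdec : ∀ x v y, guess v = msg x → dec v y = rec (msg x) y) :
    expDistortion p β enc dec ≤ sourceMean β (fun x y => distortion x (rec (msg x) y))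
      + ∑ x : Fin n → Bool, (1 / 2 : ℝ) ^ n *
        ∑ v, bscWord p (enc x) v * (if guess v = msg x then 0 else 1) := by
  rw [← sourceMean_add_of_fst hβ]
  refine sourceMean_mono hβ fun x y => ?_
  have h := (isProb_bscWord hp (enc x)).sum_mul_affine (distortion x (rec (msg x) y)) 1
    fun v => if guess v = msg x then (0 : ℝ) else 1
  rw [one_mul] at h
  rw [← h]
  refine Finset.sum_le_sum fun v _ =>
    mul_le_mul_of_nonneg_left ?_ ((isProb_bscWord hp (enc x)).nonneg v)
  split_ifs with hv
  · rw [hdec x v y hv]; linarith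
  · have h1 := distortion_nonneg x (rec (msg x) y)
    have h2 := distortion_le_one x (dec v y)
    linarith

/-- A function on a finite group has a translate whose mean under `f` is at most its average. -/
theorem exists_shift_le {Ω A : Type*} [Fintype Ω] [Fintype A] [AddGroup A] {P : Ω → ℝ}
    (hP : IsProb P) (f : Ω → A) (e : A → ℝ) :
    ∃ t : A, ∑ x, P x * e (f x + t) ≤ (∑ a, e a) / Fintype.card A := by
  refine exists_le_of_sum_mul_le (isProb_uniform (G := A)) (le_of_eq ?_)
  simp only [Finset.mul_sum]
  rw [Finset.sum_comm]
  have h : ∀ x, ∑ t, (1 / Fintype.card A : ℝ) * (P x * e (f x + t))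
      = P x * ((∑ a, e a) / Fintype.card A) := fun x => by
    rw [← Equiv.sum_comp (Equiv.addLeft (f x)) e, ← Finset.mul_sum, ← Finset.mul_sum]
    simp only [Equiv.coe_addLeft]
    ring
  rw [Finset.sum_congr rfl fun x _ => h x, ← Finset.sum_mul, hP.sum_eq_one, one_mul]

/-- Combining source codes with a channel code by a common shift of the messages, which makes up
for the fact that the source messages are not uniform. -/
theorem exists_code_of_separate {m n Mb Mp : ℕ} (hMb : 0 < Mb) (hMp : 0 < Mp) {pb pg βb βg : ℝ}
    (hpb : pb ∈ Set.Icc (0 : ℝ) 1) (hpg : pg ∈ Set.Icc (0 : ℝ) 1)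
    (hβb : βb ∈ Set.Icc (0 : ℝ) 1) (hβg : βg ∈ Set.Icc (0 : ℝ) 1)
    (s : SourceCode n Mb Mp) (c : ChannelCode m Mb Mp) :
    ∃ j : Code m n,
      expDistortion pb βb j.enc j.decB
        ≤ sourceMean βb (fun x y => distortion x (s.decB (s.enc x).1 y))
          + (c.errB pb + c.errG pg) ∧
      expDistortion pg βg j.enc j.decG
        ≤ sourceMean βg (fun x y => distortion x (s.decG (s.enc x) y))
          + (c.errB pb + c.errG pg) := by
  have : NeZero Mb := ⟨hMb.ne'⟩
  have : NeZero Mp := ⟨hMp.ne'⟩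
  set eB : Fin Mb × Fin Mp → ℝ := fun w =>
    ∑ v : Fin m → Bool, bscWord pb (c.enc w) v * (if c.decB v = w.1 then 0 else 1) with heB
  set eG : Fin Mb × Fin Mp → ℝ := fun w =>
    ∑ v : Fin m → Bool, bscWord pg (c.enc w) v * (if c.decG v = w then 0 else 1) with heG
  have hB0 : ∀ w, 0 ≤ eB w := fun w => Finset.sum_nonneg fun v _ =>
    mul_nonneg ((isProb_bscWord hpb _).nonneg v) (by split_ifs <;> norm_num)
  have hG0 : ∀ w, 0 ≤ eG w := fun w => Finset.sum_nonneg fun v _ =>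
    mul_nonneg ((isProb_bscWord hpg _).nonneg v) (by split_ifs <;> norm_num)
  have herr : (∑ w, (eB w + eG w)) / Fintype.card (Fin Mb × Fin Mp)
      = c.errB pb + c.errG pg := by
    rw [Finset.sum_add_distrib, add_div, Fintype.card_prod, Fintype.card_fin, Fintype.card_fin,
      Nat.cast_mul]
    rfl
  -- A single t must serve both receivers, so the sum of the two errors is averaged.
  obtain ⟨t, ht⟩ := exists_shift_le (isProb_half n) s.enc fun w => eB w + eG w
  rw [herr] at ht
  simp only [mul_add, Finset.sum_add_distrib] at ht
  have hsB : 0 ≤ ∑ x : Fin n → Bool, (1 / 2 : ℝ) ^ n * eB (s.enc x + t) :=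
    Finset.sum_nonneg fun x _ => mul_nonneg (by positivity) (hB0 _)
  have hsG : 0 ≤ ∑ x : Fin n → Bool, (1 / 2 : ℝ) ^ n * eG (s.enc x + t) :=
    Finset.sum_nonneg fun x _ => mul_nonneg (by positivity) (hG0 _)
  refine ⟨⟨fun x => c.enc (s.enc x + t), fun v => s.decB (c.decB v - t.1),
    fun v => s.decG (c.decG v - t)⟩, ?_, ?_⟩
  · have h := expDistortion_le hpb hβb (fun x => c.enc (s.enc x + t))
      (fun v => s.decB (c.decB v - t.1)) (fun x => (s.enc x + t).1)
      (fun a => s.decB (a - t.1)) c.decB (fun x v y hv => by rw [hv])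
    simp only [Prod.fst_add, add_sub_cancel_right] at h
    simp only [heB, heG, Prod.fst_add] at ht hsG
    linarith
  · have h := expDistortion_le hpg hβg (fun x => c.enc (s.enc x + t))
      (fun v => s.decG (c.decG v - t)) (fun x => s.enc x + t)
      (fun a => s.decG (a - t)) c.decG (fun x v y hv => by rw [hv])
    simp only [add_sub_cancel_right] at h
    simp only [heG] at ht
    linarith

/-- A point in both regions does not by itself give codes with equal message sets. Here the channel
code fixes `Mb` and `Mp` first, and the Wyner-Ziv codes are then built with exactly these sizes,
tolerating rates δ below nominal. -/
theorem achievable_of_rates {κ : ℚ} (hκ : 0 < κ) {pb pg βb βg θ αb qb αg qg Db Dg : ℝ}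
    (hpb : pb ∈ Set.Icc (0 : ℝ) 1) (hpg : pg ∈ Set.Icc (0 : ℝ) 1)
    (hβb : βb ∈ Set.Icc (0 : ℝ) 1) (hβg : βg ∈ Set.Icc (0 : ℝ) 1)
    (hθ : θ ∈ Set.Icc (0 : ℝ) 1) (hchannel : IsDegraded pg pb)
    (hqb : qb ∈ Set.Icc (0 : ℝ) 1) (hqg : qg ∈ Set.Icc (0 : ℝ) 1)
    (hαb : αb ∈ Set.Icc (0 : ℝ) (1 / 2)) (hαg : αg ∈ Set.Icc (0 : ℝ) (1 / 2))
    (hRb : qb * r αb βb ≤ κ * (1 - H2 (binConv θ pb)))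
    (hRp : qg * r αg βg ≤ κ * (H2 (binConv θ pg) - H2 pg))
    (hDb : qb * min αb βb + (1 - qb) * βb ≤ Db) (hDg : qg * min αg βg + (1 - qg) * βg ≤ Dg) :
    Achievable κ pb pg βb βg Db Dg := by
  intro ε hε
  obtain ⟨δb, hδb, nb, hb⟩ := exists_wynerZiv_code hαb hβb hqb (half_pos hε)
  obtain ⟨δg, hδg, ng, hg⟩ := exists_wynerZiv_code hαg hβg hqg (half_pos hε)
  set δ := min (ε / 2) (min δb δg) with hδ
  have hδ0 : 0 < δ := lt_min (half_pos hε) (lt_min hδb hδg)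
  have hδε : δ ≤ ε / 2 := min_le_left _ _
  have hδδb : δ ≤ δb := (min_le_right _ _).trans (min_le_left _ _)
  have hδδg : δ ≤ δg := (min_le_right _ _).trans (min_le_right _ _)
  obtain ⟨nc, hc⟩ := exists_channel_code_per_symbol hκ hpb hpg hθ hchannel hRb hRp hδ0
  refine ⟨max nc (max nb ng), fun m n _ hn hmn => ?_⟩
  simp only [max_lt_iff] at hn
  obtain ⟨Mb, Mp, c, h0, h1, h2, h3, h4⟩ := hc m n hn.1 hmn
  have hn0 : (0 : ℝ) ≤ n := Nat.cast_nonneg n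
  obtain ⟨encb, decb, hcb⟩ := hb n hn.2.1 Mb h0
    ((mul_le_mul_of_nonneg_left (by linarith) hn0).trans h2)
  obtain ⟨encg, decg, hcg⟩ := hg n hn.2.2 Mp h1
    ((mul_le_mul_of_nonneg_left (by linarith) hn0).trans h3)
  obtain ⟨j, hjb, hjg⟩ := exists_code_of_separate h0 h1 hpb hpg hβb hβg
    ⟨fun x => (encb x, encg x), decb, fun a y => decg a.2 y⟩ c
  exact ⟨j, hjb.trans (by linarith), hjg.trans (by linarith)⟩

end WZBC

/-! ### The main theorem -/

theorem mainTheorem7 (κ : ℚ) (hκ : 0 < κ) (pb pg βb βg : ℝ)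
    (hpb : pb ∈ Set.Icc (0 : ℝ) 1) (hpg : pg ∈ Set.Icc (0 : ℝ) 1)
    (hβb : βb ∈ Set.Icc (0 : ℝ) 1) (hβg : βg ∈ Set.Icc (0 : ℝ) 1)
    (hchannel : WZBC.IsDegraded pg pb)
    (Db Dg θ qb qg αb αg : ℝ)
    (hθ : θ ∈ Set.Icc (0 : ℝ) 1)
    (hqb : qb ∈ Set.Icc (0 : ℝ) 1) (hqg : qg ∈ Set.Icc (0 : ℝ) 1)
    (hαb : αb ∈ Set.Icc (0 : ℝ) (1 / 2)) (hαg : αg ∈ Set.Icc (0 : ℝ) (1 / 2))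
    (hRb : qb * WZBC.r αb βb ≤ κ * (1 - WZBC.H2 (WZBC.binConv θ pb)))
    (hRg :
      (WZBC.IsDegraded βg βb ∧
        qb * WZBC.r αb βb + max (qg * WZBC.r αg βg - qb * WZBC.r αb βg) 0
          ≤ κ * (WZBC.H2 (WZBC.binConv θ pg) - WZBC.H2 pg)) ∨
      (WZBC.IsDegraded βb βg ∧
        qg * WZBC.r αg βg + max (qb * WZBC.r αb βb - qg * WZBC.r αg βb) 0
          ≤ κ * (WZBC.H2 (WZBC.binConv θ pg) - WZBC.H2 pg)))
    (hDb : qb * min αb βb + (1 - qb) * βb ≤ Db)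
    (hDg : qg * min αg βg + (1 - qg) * βg ≤ Dg) :
    WZBC.SeparatelyAchievable κ pb pg βb βg Db Dg ∧
      WZBC.Achievable κ pb pg βb βg Db Dg := by
  -- The private layer has room for a complete description of the source for receiver `g`.
  have hRp : qg * WZBC.r αg βg ≤ κ * (WZBC.H2 (WZBC.binConv θ pg) - WZBC.H2 pg) := by
    rcases hRg with ⟨hdeg, h⟩ | ⟨-, h⟩
    · have h1 : WZBC.r αb βg ≤ WZBC.r αb βb :=
        sub_le_sub_right (hdeg.H2_binConv_le ⟨hαb.1, by linarith [hαb.2]⟩ hβg) _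
      have h2 := mul_le_mul_of_nonneg_left h1 hqb.1
      linarith [le_max_left (qg * WZBC.r αg βg - qb * WZBC.r αb βg) 0]
    · linarith [le_max_right (qb * WZBC.r αb βb - qg * WZBC.r αg βb) 0]
  -- The common rate pair is (q_b r(α_b,β_b), q_b r(α_b,β_b) + q_g r(α_g,β_g)), since the rate at
  -- `g` is cumulative.
  exact ⟨⟨_, WZBC.mem_sourceRegion hβb hβg hqb hqg hαb hαg hDb hDg,
      WZBC.mem_capacityRegion hκ hpb hpg hθ hchannel hRb hRp⟩,
    WZBC.achievable_of_rates hκ hpb hpg hβb hβg hθ hchannel hqb hqg hαb hαg hRb hRp hDb hDg⟩
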